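/- Let $(X,\mu)$ be a standard Borel space with a non-atomic finite or $\sigma$-finite measure, and let $\mathrm{Aut}(X,\mu)$ be the group of invertible measure-preserving transformations of $X$, where transformations that agree almost everywhere are identified. Let $1\le p<\infty$, and equip $\mathrm{Aut}(X,\mu)$ with the weak topology, that is, the topology induced by the strong operator topology under the representation $T\cdot f=f\circ T^{-1}$ by isometries of $L^p(X,\mu)$. Then $\mathrm{Aut}(X,\mu)$ is a Hausdorff topological group with the following two properties. (1) It is a Lévy group: it has a family $\mathcal K$ of compact subgroups, directed by inclusion and with everywhere dense union, such that the normalized Haar measures $\mu_K$, $K\in\mathcal K$, concentrate with respect to the right uniform structure. Here concentration means that whenever $(A_K)_{K\in\mathcal K}$ are Borel subsets of the group with $\liminf_K \mu_K(A_K)>0$, one has $\lim_K\mu_K(VA_K)=1$ for every neighbourhood $V$ of the identity. (2) It is extremely amenable: every continuous action of it on a non-empty compact Hausdorff space has a fixed point. -/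

import Mathlib

open MeasureTheory Filter Topology
open scoped ENNReal

universe u v

/-! ### Concentration, Lévy groups and extreme amenability -/

/-- A family `ν` of measures on a uniform space, indexed by a directed set, *concentrates* if for
all Borel sets `A i` with `liminf ν i (A i) > 0` and every entourage `V`, the measure of the
`V`-neighbourhood `V[A i] = {x | ∃ a ∈ A i, (x, a) ∈ V}` tends to `1`. -/
def Concentrates {ι Y : Type*} [Preorder ι] [UniformSpace Y] [MeasurableSpace Y]
    (ν : ι → Measure Y) : Prop :=
  ∀ A : ι → Set Y, (∀ i, MeasurableSet (A i)) → 0 < liminf (fun i => ν i (A i)) atTop →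
    ∀ V ∈ uniformity Y,
      Tendsto (fun i => ν i {x | ∃ a ∈ A i, (x, a) ∈ V}) atTop (𝓝 1)

/-- The Haar probability measure of a compact subgroup `K` of `G`, as a Borel measure on `G`. -/
noncomputable def compactSubgroupHaar {G : Type*} [Group G] [TopologicalSpace G]
    [IsTopologicalGroup G] [MeasurableSpace G] [BorelSpace G]
    (K : Subgroup G) (hK : IsCompact (K : Set G)) : Measure G :=
  haveI : CompactSpace K := isCompact_iff_compactSpace.mp hK
  (Measure.haarMeasure (⊤ : TopologicalSpace.PositiveCompacts K)).map Subtype.val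

/-- A topological group is a *Lévy group* if it has a family of compact subgroups, directed by
inclusion, with dense union, whose Haar probability measures concentrate with respect to the right
uniform structure (basic entourages `{(x, y) | x * y⁻¹ ∈ V}`). -/
def IsLevyGroup (G : Type*) [Group G] [TopologicalSpace G] [IsTopologicalGroup G] : Prop :=
  letI : UniformSpace G := IsTopologicalGroup.rightUniformSpace G
  letI : MeasurableSpace G := borel G
  haveI : BorelSpace G := ⟨rfl⟩
  ∃ (𝒦 : Set (Subgroup G)) (h𝒦 : ∀ K ∈ 𝒦, IsCompact (K : Set G)),
    𝒦.Nonempty ∧ DirectedOn (· ≤ ·) 𝒦 ∧ Dense (⋃ K ∈ 𝒦, (K : Set G)) ∧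
      Concentrates (fun K : 𝒦 => compactSubgroupHaar K.1 (h𝒦 K.1 K.2))

/-- A topological group is *extremely amenable* if every (jointly) continuous action on a nonempty
compact Hausdorff space has a fixed point. -/
def IsExtremelyAmenable (G : Type u) [Group G] [TopologicalSpace G] : Prop :=
  ∀ (K : Type v) [TopologicalSpace K] [CompactSpace K] [T2Space K] [Nonempty K]
    [MulAction G K] [ContinuousSMul G K], ∃ x : K, ∀ g : G, g • x = x

/-! ### The group of measure-preserving automorphisms modulo null sets -/

/-- Bijective bimeasurable measure-preserving maps of `X` onto itself. -/
def MPEquiv {X : Type*} [MeasurableSpace X] (μ : Measure X) : Type _ :=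
  {e : X ≃ᵐ X // MeasurePreserving e μ μ}

namespace MPEquiv

variable {X : Type*} [MeasurableSpace X] {μ : Measure X}

instance : Group (MPEquiv μ) where
  mul a b := ⟨b.1.trans a.1, a.2.comp b.2⟩
  one := ⟨MeasurableEquiv.refl X, MeasurePreserving.id μ⟩
  inv a := ⟨a.1.symm, a.2.symm a.1⟩
  mul_assoc _ _ _ := rfl
  one_mul _ := rfl
  mul_one _ := rfl
  inv_mul_cancel a := Subtype.ext (MeasurableEquiv.ext (funext fun x => a.1.symm_apply_apply x))

theorem mul_apply (a b : MPEquiv μ) (x : X) : (a * b).1 x = a.1 (b.1 x) := rfl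

theorem one_apply (x : X) : (1 : MPEquiv μ).1 x = x := rfl

theorem inv_apply (a : MPEquiv μ) (x : X) : (a⁻¹).1 x = a.1.symm x := rfl

/-- The transformations that are equal to the identity almost everywhere. -/
def aeTrivial (μ : Measure X) : Subgroup (MPEquiv μ) where
  carrier := {a | ∀ᵐ x ∂μ, a.1 x = x}
  one_mem' := by
    rw [Set.mem_ofPred_eq]
    exact Eventually.of_forall fun _ => rfl
  mul_mem' := by
    intro a b ha hb
    rw [Set.mem_ofPred_eq] at ha hb ⊢
    filter_upwards [ha, hb] with x hx hy
    rw [mul_apply, hy, hx]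
  inv_mem' := by
    intro a ha
    rw [Set.mem_ofPred_eq] at ha ⊢
    filter_upwards [ha] with x hx
    rw [inv_apply, MeasurableEquiv.symm_apply_eq, hx]

instance : (aeTrivial μ).Normal where
  conj_mem := by
    intro n hn g
    have h := (g⁻¹).2.quasiMeasurePreserving.ae hn
    filter_upwards [h] with x hx
    rw [mul_apply, mul_apply, hx, inv_apply, MeasurableEquiv.apply_symm_apply]

/-- The action of measure-preserving transformations on `L^p` by `a • f = f ∘ a⁻¹`. -/
noncomputable def koopman (p : ℝ≥0∞) [Fact (1 ≤ p)] (μ : Measure X) :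
    MPEquiv μ →* (Lp ℝ p μ ≃ₗᵢ[ℝ] Lp ℝ p μ) where
  toFun a :=
    { Lp.compMeasurePreservingₗᵢ ℝ (a⁻¹).1 (a⁻¹).2 with
      invFun := Lp.compMeasurePreserving a.1 a.2
      left_inv := by
        intro f
        change Lp.compMeasurePreserving a.1 a.2
          (Lp.compMeasurePreserving (a⁻¹).1 (a⁻¹).2 f) = f
        rw [← AddMonoidHom.comp_apply, ← Lp.compMeasurePreserving_comp (a⁻¹).2 a.2]
        have h : (a⁻¹).1 ∘ a.1 = id := funext fun x => a.1.symm_apply_apply x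
        simp only [h]
        simp
      right_inv := by
        intro f
        change Lp.compMeasurePreserving (a⁻¹).1 (a⁻¹).2
          (Lp.compMeasurePreserving a.1 a.2 f) = f
        rw [← AddMonoidHom.comp_apply, ← Lp.compMeasurePreserving_comp a.2 (a⁻¹).2]
        have h : a.1 ∘ (a⁻¹).1 = id := funext fun x => a.1.apply_symm_apply x
        simp only [h]
        simp }
  map_one' := by
    ext1 f
    exact Lp.compMeasurePreserving_id_apply f
  map_mul' a b := by
    ext1 f
    exact DFunLike.congr_fun (Lp.compMeasurePreserving_comp (b⁻¹).2 (a⁻¹).2) f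

theorem koopman_apply (p : ℝ≥0∞) [Fact (1 ≤ p)] (a : MPEquiv μ) (f : Lp ℝ p μ) :
    koopman p μ a f = Lp.compMeasurePreserving (a⁻¹).1 (a⁻¹).2 f := rfl

theorem aeTrivial_le_ker_koopman (p : ℝ≥0∞) [Fact (1 ≤ p)] :
    aeTrivial μ ≤ (koopman p μ).ker := by
  intro a ha
  rw [MonoidHom.mem_ker]
  ext1 f
  rw [koopman_apply]
  apply Lp.ext
  have ha' : ∀ᵐ x ∂μ, (a⁻¹).1 x = x := (aeTrivial μ).inv_mem ha
  filter_upwards [Lp.coeFn_compMeasurePreserving f (a⁻¹).2, ha'] with x hx hy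
  rw [hx, Function.comp_apply, hy]
  rfl

end MPEquiv

/-- The group `Aut(X, μ)` of measure-preserving automorphisms, where transformations that agree
almost everywhere are identified; the parameter `p` names the space `L^p` that is used to define
the weak topology below. -/
def WeakAut {X : Type*} [MeasurableSpace X] (_p : ℝ≥0∞) (μ : Measure X) : Type _ :=
  MPEquiv μ ⧸ MPEquiv.aeTrivial μ

namespace WeakAut

variable {X : Type*} [MeasurableSpace X]

instance (p : ℝ≥0∞) (μ : Measure X) : Group (WeakAut p μ) :=
  inferInstanceAs (Group (MPEquiv μ ⧸ MPEquiv.aeTrivial μ))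

/-- The quasi-regular representation of `Aut(X, μ)` on `L^p` by linear isometries,
`[a] • f = f ∘ a⁻¹`. -/
noncomputable def rep (p : ℝ≥0∞) [Fact (1 ≤ p)] (μ : Measure X) :
    WeakAut p μ →* (Lp ℝ p μ ≃ₗᵢ[ℝ] Lp ℝ p μ) :=
  QuotientGroup.lift (MPEquiv.aeTrivial μ) (MPEquiv.koopman p μ)
    (MPEquiv.aeTrivial_le_ker_koopman p)

/-- The weak topology: the topology induced by the strong operator topology, that is, by pointwise
norm convergence on `L^p`. -/
noncomputable instance (p : ℝ≥0∞) [Fact (1 ≤ p)] (μ : Measure X) : TopologicalSpace (WeakAut p μ) :=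
  TopologicalSpace.induced (fun (T : WeakAut p μ) (f : Lp ℝ p μ) => rep p μ T f)
    Pi.topologicalSpace

theorem tendsto_iff {p : ℝ≥0∞} [Fact (1 ≤ p)] {μ : Measure X} {α : Type*} {l : Filter α}
    {u : α → WeakAut p μ} {T : WeakAut p μ} :
    Tendsto u l (𝓝 T) ↔ ∀ f : Lp ℝ p μ, Tendsto (fun i => rep p μ (u i) f) l (𝓝 (rep p μ T f)) := by
  rw [nhds_induced, tendsto_comap_iff, tendsto_pi_nhds]
  rfl

instance (p : ℝ≥0∞) [Fact (1 ≤ p)] (μ : Measure X) : IsTopologicalGroup (WeakAut p μ) where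
  continuous_mul := by
    rw [continuous_iff_continuousAt]
    rintro ⟨S, T⟩
    refine tendsto_iff.mpr fun f => ?_
    have hS : Tendsto (fun q : WeakAut p μ × WeakAut p μ => rep p μ q.1 (rep p μ T f)) (𝓝 (S, T))
        (𝓝 (rep p μ S (rep p μ T f))) := tendsto_iff.mp (continuous_fst.tendsto (S, T)) _
    have hT : Tendsto (fun q : WeakAut p μ × WeakAut p μ => rep p μ q.2 f) (𝓝 (S, T))
        (𝓝 (rep p μ T f)) := tendsto_iff.mp (continuous_snd.tendsto (S, T)) _
    rw [tendsto_iff_dist_tendsto_zero] at hS hT ⊢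
    refine squeeze_zero (fun _ => dist_nonneg) (fun q => ?_) (by simpa using hT.add hS)
    simp only [map_mul, LinearIsometryEquiv.coe_mul, Function.comp_apply]
    refine (dist_triangle _ (rep p μ q.1 (rep p μ T f)) _).trans ?_
    rw [LinearIsometryEquiv.dist_map]
  continuous_inv := by
    rw [continuous_iff_continuousAt]
    intro T
    refine tendsto_iff.mpr fun f => ?_
    have h : Tendsto (fun S : WeakAut p μ => rep p μ S (rep p μ T⁻¹ f)) (𝓝 T)
        (𝓝 (rep p μ T (rep p μ T⁻¹ f))) := tendsto_iff.mp tendsto_id _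
    rw [tendsto_iff_dist_tendsto_zero] at h ⊢
    refine h.congr fun S => ?_
    have key : ∀ R : WeakAut p μ, rep p μ R (rep p μ R⁻¹ f) = f := fun R => by
      rw [← Function.comp_apply (f := rep p μ R), ← LinearIsometryEquiv.coe_mul, ← map_mul,
        mul_inv_cancel, map_one]
      rfl
    rw [key T, ← (rep p μ S).dist_map (rep p μ S⁻¹ f), key S, dist_comm]

end WeakAut

open scoped symmDiff

/-! ### Concentration of measure in the symmetric groups -/

/-! Modulo null sets, a non-atomic `σ`-finite standard Borel space of nonzero measure is an interval
`[0, M)` with Lebesgue measure (`exists_ae_equiv_initialInterval`). Cut initial segments of it into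
`N` cells of equal length `ℓ` and let the symmetric group permute the cells by translations.
Refining the cells and, if `M = ∞`, lengthening the segments gives an increasing sequence of finite
groups of automorphisms (`nonempty_exchangeSystem`).

Their union is dense: an automorphism carries coarse cells to sets that are nearly unions of much
finer cells, and matching fine cells by counting gives a permutation with nearly the same effect
(`exists_measure_symmDiff_le`). Since `p` is finite, closeness on finitely many sets of finite
measure is closeness in the weak topology (`WeakAut.exists_finset_of_mem_nhds`).

They concentrate: a Poincaré inequality bounds the variance of Hamming-Lipschitz functions on the
symmetric group by a multiple of `N`, so at most a fraction `O(N / (c t²))` of the permutations is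
at distance `t` or more from a set of proportion `c` (`card_mul_card_far_mul_sq_le`). Moving `d`
cells changes points only on a set of measure at most `d ℓ`, so a neighbourhood of the identity
corresponds to `t = δ / ℓ`. The exceptional fraction is then `O(ℓ² N)`, and the scales are chosen so
that `ℓ² N → 0`.

Extreme amenability holds for every Lévy group (`IsLevyGroup.isExtremelyAmenable`): concentration
along an orbit map yields almost fixed points for finite sets of group elements, and compactness
turns them into a fixed point. -/

theorem sum_sum_sub_sq {α : Type*} [Fintype α] (f : α → ℝ) :
    ∑ x, ∑ y, (f x - f y) ^ 2 = 2 * (Fintype.card α * ∑ x, f x ^ 2) - 2 * (∑ x, f x) ^ 2 := by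
  simp only [sub_sq, Finset.sum_add_distrib, Finset.sum_sub_distrib, Finset.sum_const,
    Finset.card_univ, nsmul_eq_mul, ← Finset.mul_sum, ← Finset.sum_mul]
  ring

/-- This is the law of total variance, cleared of denominators: mean of the conditional variances
plus variance of the conditional means. It drives the induction in the Poincaré inequality. -/
theorem sum_sum_sub_sq_prod {α β : Type*} [Fintype α] [Fintype β] (f : α × β → ℝ) :
    ∑ x, ∑ y, (f x - f y) ^ 2 =
      Fintype.card α * ∑ a, ∑ b, ∑ c, (f (a, b) - f (a, c)) ^ 2 +
        ∑ a, ∑ c, (∑ b, f (a, b) - ∑ b, f (c, b)) ^ 2 := by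
  rw [sum_sum_sub_sq f, sum_sum_sub_sq fun a => ∑ b, f (a, b)]
  simp only [fun a => sum_sum_sub_sq fun b => f (a, b), Finset.sum_sub_distrib, ← Finset.mul_sum,
    Fintype.sum_prod_type, Fintype.card_prod]
  push_cast
  ring

theorem hammingDist_perm_mul_right {α : Type*} [Fintype α] [DecidableEq α]
    (s a b : Equiv.Perm α) : hammingDist (⇑(a * s)) (⇑(b * s)) = hammingDist ⇑a ⇑b := by
  refine Finset.card_equiv s fun i => ?_
  rw [Finset.mem_filter_univ, Finset.mem_filter_univ]
  rfl

theorem hammingDist_decomposeFin_symm_snd {n : ℕ} (p : Fin (n + 1)) (a b : Equiv.Perm (Fin n)) :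
    hammingDist ⇑(Equiv.Perm.decomposeFin.symm (p, a)) ⇑(Equiv.Perm.decomposeFin.symm (p, b)) ≤
      hammingDist ⇑a ⇑b := by
  simp only [hammingDist]
  rw [← Finset.card_map (Fin.succEmb n)]
  refine Finset.card_le_card fun i => ?_
  refine Fin.cases ?_ (fun j => ?_) i <;> simp

/-- After the common right factor is cancelled, only the transpositions `(0 p)` and `(0 q)` are
compared, and these agree off `{0, p, q}`. -/
theorem hammingDist_decomposeFin_symm_fst {n : ℕ} (p q : Fin (n + 1)) (a : Equiv.Perm (Fin n)) :
    hammingDist ⇑(Equiv.Perm.decomposeFin.symm (p, a)) ⇑(Equiv.Perm.decomposeFin.symm (q, a)) ≤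
      3 := by
  have h : ∀ p : Fin (n + 1), Equiv.Perm.decomposeFin.symm (p, a) =
      Equiv.swap 0 p * Equiv.Perm.decomposeFin.symm (0, a) := fun p => by
    ext i
    refine Fin.cases ?_ (fun j => ?_) i <;> simp
  rw [h p, h q, hammingDist_perm_mul_right]
  refine le_trans (Finset.card_le_card (t := {0, p, q}) fun i hi => ?_) Finset.card_le_three
  by_contra hi'
  simp only [Finset.mem_insert, Finset.mem_singleton, not_or] at hi'
  simp [Equiv.swap_apply_of_ne_of_ne hi'.1 hi'.2.1,
    Equiv.swap_apply_of_ne_of_ne hi'.1 hi'.2.2] at hi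

/-- A Poincaré inequality on the symmetric group with the Hamming metric. -/
theorem sum_sum_sub_sq_perm_fin_le (n : ℕ) (f : Equiv.Perm (Fin n) → ℝ)
    (hf : ∀ s t, |f s - f t| ≤ hammingDist ⇑s ⇑t) :
    ∑ s, ∑ t, (f s - f t) ^ 2 ≤ 9 * n * (Fintype.card (Equiv.Perm (Fin n))) ^ 2 := by
  induction n with
  | zero => simp
  | succ n ih =>
    have key : ∑ s, ∑ t, (f s - f t) ^ 2 = ∑ x : Fin (n + 1) × Equiv.Perm (Fin n),
        ∑ y : Fin (n + 1) × Equiv.Perm (Fin n),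
          (f (Equiv.Perm.decomposeFin.symm x) - f (Equiv.Perm.decomposeFin.symm y)) ^ 2 := by
      rw [← Equiv.sum_comp (Equiv.Perm.decomposeFin (n := n)).symm]
      refine Finset.sum_congr rfl fun x _ => ?_
      rw [← Equiv.sum_comp (Equiv.Perm.decomposeFin (n := n)).symm]
    -- Fibres over the first coordinate fall under the induction hypothesis. Fibre means differ by
    -- at most `3`, which adds `3² = 9` to the constant `9 * n`.
    rw [key, sum_sum_sub_sq_prod fun x => f (Equiv.Perm.decomposeFin.symm x),
      Fintype.card_congr (Equiv.Perm.decomposeFin (n := n)), Fintype.card_prod, Fintype.card_fin]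
    have h1 : ∀ a : Fin (n + 1), ∑ b, ∑ c, (f (Equiv.Perm.decomposeFin.symm (a, b)) -
        f (Equiv.Perm.decomposeFin.symm (a, c))) ^ 2 ≤
          9 * n * (Fintype.card (Equiv.Perm (Fin n))) ^ 2 := fun a =>
      ih (fun b => f (Equiv.Perm.decomposeFin.symm (a, b))) fun s t => (hf _ _).trans
        (by exact_mod_cast hammingDist_decomposeFin_symm_snd a s t)
    have h2 : ∀ a c : Fin (n + 1), (∑ b, f (Equiv.Perm.decomposeFin.symm (a, b)) -
        ∑ b, f (Equiv.Perm.decomposeFin.symm (c, b))) ^ 2 ≤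
          (Fintype.card (Equiv.Perm (Fin n)) * 3) ^ 2 := fun a c => by
      refine sq_le_sq' ?_ ?_ <;> rw [← Finset.sum_sub_distrib]
      · rw [neg_le, ← Finset.sum_neg_distrib]
        refine (Finset.sum_le_card_nsmul _ _ 3 fun b _ => ?_).trans (by simp)
        refine (neg_le_abs _).trans ((hf _ _).trans ?_)
        exact_mod_cast hammingDist_decomposeFin_symm_fst a c b
      · refine (Finset.sum_le_card_nsmul _ _ 3 fun b _ => ?_).trans (by simp)
        refine (le_abs_self _).trans ((hf _ _).trans ?_)
        exact_mod_cast hammingDist_decomposeFin_symm_fst a c b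
    have h3 := Finset.sum_le_card_nsmul Finset.univ _ _ fun a _ => h1 a
    have h4 := Finset.sum_le_card_nsmul Finset.univ _ _ fun a _ =>
      Finset.sum_le_card_nsmul Finset.univ _ _ fun c _ => h2 a c
    simp only [Finset.card_univ, Fintype.card_fin, nsmul_eq_mul] at h3 h4
    refine (add_le_add (mul_le_mul_of_nonneg_left h3 (by positivity)) h4).trans (le_of_eq ?_)
    push_cast
    ring

theorem sum_sum_sub_sq_perm_le {α : Type*} [Fintype α] [DecidableEq α] (f : Equiv.Perm α → ℝ)
    (hf : ∀ s t, |f s - f t| ≤ hammingDist ⇑s ⇑t) :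
    ∑ s, ∑ t, (f s - f t) ^ 2 ≤
      9 * Fintype.card α * (Fintype.card (Equiv.Perm α)) ^ 2 := by
  let e := (Fintype.equivFin α).symm.permCongr
  have h := sum_sum_sub_sq_perm_fin_le (Fintype.card α) (fun s => f (e s)) fun s t => by
    refine (hf _ _).trans (le_of_eq ?_)
    simp only [hammingDist]
    norm_cast
    refine Finset.card_equiv (Fintype.equivFin α) fun i => ?_
    simp [e, Equiv.permCongr_apply]
  rw [Fintype.card_congr e] at h
  refine le_trans (le_of_eq ?_) h
  rw [← Equiv.sum_comp e]
  refine Finset.sum_congr rfl fun x _ => ?_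
  rw [← Equiv.sum_comp e]

/-- Concentration of measure in the symmetric group: few permutations are far from a large set. -/
theorem card_mul_card_far_mul_sq_le {α : Type*} [Fintype α] [DecidableEq α]
    (A B : Finset (Equiv.Perm α)) (t : ℝ) (ht : 0 ≤ t)
    (hB : ∀ b ∈ B, ∀ a ∈ A, t ≤ hammingDist ⇑b ⇑a) :
    (A.card : ℝ) * B.card * t ^ 2 ≤ 9 * Fintype.card α * (Fintype.card (Equiv.Perm α)) ^ 2 := by
  rcases A.eq_empty_or_nonempty with rfl | hA
  · simp; positivity
  -- The distance to `A` is 1-Lipschitz, vanishes on `A` and is at least `t` on `B`, so each pair in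
  -- `A × B` contributes at least `t ^ 2` to the Poincaré sum.
  let f : Equiv.Perm α → ℝ := fun s => A.inf' hA fun a => (hammingDist ⇑s ⇑a : ℝ)
  have hf1 : ∀ s t, f s - f t ≤ hammingDist ⇑s ⇑t := fun s t => by
    obtain ⟨a, ha, hat⟩ := Finset.exists_mem_eq_inf' hA fun a => (hammingDist ⇑t ⇑a : ℝ)
    have h1 : f s ≤ hammingDist ⇑s ⇑a := Finset.inf'_le _ ha
    have h2 : f t = hammingDist ⇑t ⇑a := hat
    have h3 : (hammingDist ⇑s ⇑a : ℝ) ≤ hammingDist ⇑s ⇑t + hammingDist ⇑t ⇑a := by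
      exact_mod_cast hammingDist_triangle _ _ _
    linarith
  have hf : ∀ s t, |f s - f t| ≤ hammingDist ⇑s ⇑t := fun s t =>
    abs_le'.mpr ⟨hf1 s t, by rw [neg_sub, hammingDist_comm]; exact hf1 t s⟩
  refine le_trans ?_ (sum_sum_sub_sq_perm_le f hf)
  have hfA : ∀ a ∈ A, f a ≤ 0 := fun a ha => (Finset.inf'_le _ ha).trans (by simp)
  have hfB : ∀ b ∈ B, t ≤ f b := fun b hb => Finset.le_inf' _ _ fun a ha => hB b hb a ha
  calc (A.card : ℝ) * B.card * t ^ 2 = ∑ a ∈ A, ∑ b ∈ B, t ^ 2 := by simp; ring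
    _ ≤ ∑ a ∈ A, ∑ b ∈ B, (f a - f b) ^ 2 := by
        refine Finset.sum_le_sum fun a ha => Finset.sum_le_sum fun b hb => ?_
        have := hfA a ha
        have := hfB b hb
        nlinarith
    _ ≤ ∑ a ∈ A, ∑ b, (f a - f b) ^ 2 := by
        refine Finset.sum_le_sum fun a _ => ?_
        exact Finset.sum_le_univ_sum_of_nonneg fun b => sq_nonneg _
    _ ≤ ∑ a, ∑ b, (f a - f b) ^ 2 :=
        Finset.sum_le_univ_sum_of_nonneg fun a => Finset.sum_nonneg fun b _ => sq_nonneg _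

/-- If `C j` and `R j` are two disjoint families of finite sets, some permutation maps as many
elements of each `C j` as possible into `R j`. -/
theorem exists_perm_card_filter_notMem_le {α J : Type*} [Fintype α] [DecidableEq α]
    (C R : J → Finset α) (hC : Pairwise (Function.onFun Disjoint C))
    (hR : Pairwise (Function.onFun Disjoint R)) :
    ∃ s : Equiv.Perm α, ∀ j, ((C j).filter fun i => s i ∉ R j).card ≤ (C j).card - (R j).card := by
  have emb : ∀ (S : J → Finset α) (_ : Pairwise (Function.onFun Disjoint S)) (k : J → ℕ)
      (_ : ∀ j, k j ≤ (S j).card), ∃ f : (Σ j, Fin (k j)) → α,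
        Function.Injective f ∧ ∀ x, f x ∈ S x.1 := by
    intro S hS k hk
    refine ⟨fun x => (S x.1).equivFin.symm (Fin.castLE (hk x.1) x.2), ?_, fun x => by simp⟩
    rintro ⟨i, a⟩ ⟨j, b⟩ hab
    have hij : i = j := by
      by_contra hne
      refine Finset.disjoint_left.mp (hS hne)
        (Finset.coe_mem ((S i).equivFin.symm (Fin.castLE (hk i) a))) ?_
      dsimp only at hab
      rw [hab]
      exact Finset.coe_mem _
    subst hij
    simpa using hab
  -- Match `k j` elements of `C j` with as many of `R j`; by disjointness the matchings combine into
  -- one partial injection, which extends to a permutation.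
  let k : J → ℕ := fun j => min (C j).card (R j).card
  obtain ⟨f, hf, hfC⟩ := emb C hC k fun j => min_le_left _ _
  obtain ⟨g, hg, hgR⟩ := emb R hR k fun j => min_le_right _ _
  classical
  let e : {x // x ∈ Set.range f} ≃ {x // x ∈ Set.range g} :=
    (Equiv.ofInjective f hf).symm.trans (Equiv.ofInjective g hg)
  have he : ∀ x, e.extendSubtype (f x) = g x := fun x => by
    rw [Equiv.extendSubtype_apply_of_mem _ _ (Set.mem_range_self x)]
    have : (Equiv.ofInjective f hf).symm ⟨f x, Set.mem_range_self x⟩ = x :=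
      Equiv.ofInjective_symm_apply hf x
    simp [e, this]
  refine ⟨e.extendSubtype, fun j => ?_⟩
  have h1 : k j ≤ ((C j).filter fun i => e.extendSubtype i ∈ R j).card := by
    have : (Finset.univ.image fun a : Fin (k j) => f ⟨j, a⟩).card = k j := by
      rw [Finset.card_image_of_injective, Finset.card_univ, Fintype.card_fin]
      intro a b hab
      simpa using hf hab
    rw [← this]
    refine Finset.card_le_card fun i hi => ?_
    obtain ⟨a, -, rfl⟩ := Finset.mem_image.mp hi
    rw [Finset.mem_filter, he]
    exact ⟨hfC _, hgR _⟩
  have h2 := Finset.card_filter_add_card_filter_not (s := C j) fun i => e.extendSubtype i ∈ R j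
  simp only [k] at h1
  omega

/-! ### Haar measures of compact subgroups -/

section CompactSubgroupHaar

variable {G : Type*} [Group G] [TopologicalSpace G] [IsTopologicalGroup G] [MeasurableSpace G]
  [BorelSpace G]

theorem isProbabilityMeasure_compactSubgroupHaar (K : Subgroup G) (hK : IsCompact (K : Set G)) :
    IsProbabilityMeasure (compactSubgroupHaar K hK) := by
  have : CompactSpace K := isCompact_iff_compactSpace.mp hK
  have : IsProbabilityMeasure
      (Measure.haarMeasure (⊤ : TopologicalSpace.PositiveCompacts K)) :=
    ⟨by simpa using Measure.haarMeasure_self (K₀ := (⊤ : TopologicalSpace.PositiveCompacts K))⟩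
  exact Measure.isProbabilityMeasure_map measurable_subtype_coe.aemeasurable

theorem compactSubgroupHaar_preimage_mul_left (K : Subgroup G) (hK : IsCompact (K : Set G))
    {k : G} (hk : k ∈ K) {B : Set G} (hB : MeasurableSet B) :
    compactSubgroupHaar K hK ((fun g => k * g) ⁻¹' B) = compactSubgroupHaar K hK B := by
  have : CompactSpace K := isCompact_iff_compactSpace.mp hK
  unfold compactSubgroupHaar
  rw [Measure.map_apply measurable_subtype_coe hB, Measure.map_apply measurable_subtype_coe
    ((continuous_const_mul k).measurable hB)]
  exact measure_preimage_mul (Measure.haarMeasure (⊤ : TopologicalSpace.PositiveCompacts K))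
    ⟨k, hk⟩ (Subtype.val ⁻¹' B)

theorem compactSubgroupHaar_compl (K : Subgroup G) (hK : IsCompact (K : Set G))
    (hK' : MeasurableSet (K : Set G)) : compactSubgroupHaar K hK (K : Set G)ᶜ = 0 := by
  have : CompactSpace K := isCompact_iff_compactSpace.mp hK
  unfold compactSubgroupHaar
  rw [Measure.map_apply measurable_subtype_coe hK'.compl]
  convert measure_empty (μ := Measure.haarMeasure (⊤ : TopologicalSpace.PositiveCompacts K))
  ext x
  simp

end CompactSubgroupHaar

/-! ### Lévy groups are extremely amenable -/

/-- Joint continuity gives this near each point of `X`; compactness makes the neighbourhood of the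
identity uniform. -/
theorem eventually_forall_smul_mem_uniformity {G X : Type*} [Group G] [TopologicalSpace G]
    [UniformSpace X] [CompactSpace X] [MulAction G X] [ContinuousSMul G X]
    {W : Set (X × X)} (hW : W ∈ uniformity X) :
    ∀ᶠ g in 𝓝 (1 : G), ∀ x : X, (g • x, x) ∈ W := by
  have := isCompact_univ.eventually_forall_of_forall_eventually (x₀ := (1 : G))
    (P := fun g (x : X) => (g • x, x) ∈ W) fun y _ => by
      have hc : Tendsto (fun z : G × X => (z.1 • z.2, z.2)) (𝓝 (1, y)) (𝓝 ((1 : G) • y, y)) :=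
        (Continuous.prodMk continuous_smul continuous_snd).tendsto (1, y)
      rw [one_smul] at hc
      exact hc.eventually (mem_of_superset (nhds_le_uniformity y hW) subset_rfl)
  filter_upwards [this] with g hg x using hg x trivial

theorem DirectedOn.exists_forall_finset_mem {G : Type*} [Group G] {𝒦 : Set (Subgroup G)}
    (hne : 𝒦.Nonempty) (hdir : DirectedOn (· ≤ ·) 𝒦) (F : Finset G)
    (hF : ∀ g ∈ F, g ∈ ⋃ K ∈ 𝒦, (K : Set G)) : ∃ K ∈ 𝒦, ∀ g ∈ F, g ∈ K := by
  classical
  induction F using Finset.induction_on with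
  | empty => exact ⟨_, hne.some_mem, by simp⟩
  | insert a F _ ih =>
    obtain ⟨K, hK, hKF⟩ := ih fun g hg => hF g (Finset.mem_insert_of_mem hg)
    have ha := hF a (Finset.mem_insert_self a F)
    simp only [Set.mem_iUnion, SetLike.mem_coe, exists_prop] at ha
    obtain ⟨K', hK', haK'⟩ := ha
    obtain ⟨L, hL, hKL, hKL'⟩ := hdir K hK K' hK'
    refine ⟨L, hL, fun g hg => ?_⟩
    rcases Finset.mem_insert.mp hg with rfl | hg
    exacts [hKL' haK', hKL (hKF g hg)]

/-- Union bound: by left invariance the translates of `Eᶜ` all have the same measure, so they are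
too small to cover `G`. -/
theorem exists_forall_mul_mem_of_measure_lt {G : Type*} [Group G] [TopologicalSpace G]
    [IsTopologicalGroup G] [MeasurableSpace G] [BorelSpace G] (K : Subgroup G)
    (hK : IsCompact (K : Set G)) (F : Finset G) (hF : ∀ g ∈ F, g ∈ K) {E : Set G}
    (hE : MeasurableSet E) (h : F.card * compactSubgroupHaar K hK Eᶜ < 1) :
    ∃ x, ∀ g ∈ F, g * x ∈ E := by
  have := isProbabilityMeasure_compactSubgroupHaar K hK
  by_contra! hcon
  have hcov : (Set.univ : Set G) ⊆ ⋃ g ∈ F, (fun x => g * x) ⁻¹' Eᶜ := fun x _ => by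
    obtain ⟨g, hg, hgx⟩ := hcon x
    simpa using ⟨g, hg, hgx⟩
  have h1 := (measure_mono hcov).trans
    (measure_biUnion_finset_le (μ := compactSubgroupHaar K hK) F _)
  rw [measure_univ, Finset.sum_congr rfl fun g hg =>
    compactSubgroupHaar_preimage_mul_left K hK (hF g hg) hE.compl, Finset.sum_const,
    nsmul_eq_mul] at h1
  exact absurd h (not_lt.mpr h1)

/-- Finitely many small balls cover `X`, so for each `K` the orbit map of `x₀` sends a definite
proportion of `K` into one ball. By concentration, nearly all of `K` is sent near that ball; hence
some `h` and all its translates `g * h` with `g ∈ F` are sent there together, and `h • x₀` is almost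
fixed. -/
theorem IsLevyGroup.exists_forall_mem_uniformity {G X : Type*} [Group G] [TopologicalSpace G]
    [IsTopologicalGroup G] {mG : MeasurableSpace G} [BorelSpace G]
    [UniformSpace X] [CompactSpace X] [Nonempty X] [MulAction G X] [ContinuousSMul G X]
    {𝒦 : Set (Subgroup G)} (h𝒦 : ∀ K ∈ 𝒦, IsCompact (K : Set G)) (hne : 𝒦.Nonempty)
    (hdir : DirectedOn (· ≤ ·) 𝒦)
    (hconc : letI : UniformSpace G := IsTopologicalGroup.rightUniformSpace G
      Concentrates (fun K : 𝒦 => compactSubgroupHaar K.1 (h𝒦 K.1 K.2)))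
    (F : Finset G) (hF : ∀ g ∈ F, g ∈ ⋃ K ∈ 𝒦, (K : Set G)) {W : Set (X × X)}
    (hW : W ∈ uniformity X) : ∃ x : X, ∀ g ∈ F, (x, g • x) ∈ W := by
  classical
  obtain ⟨W₂, hW₂, _, hW₂W⟩ := comp_symm_mem_uniformity_sets hW
  obtain ⟨W₁, hW₁, _, hW₁W⟩ := comp_symm_mem_uniformity_sets hW₂
  obtain ⟨x₀⟩ := ‹Nonempty X›
  obtain ⟨t, -, ht⟩ := isCompact_univ.elim_nhds_subcover
    (fun y : X => interior (UniformSpace.ball y W₁))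
    fun y _ => interior_mem_nhds.mpr (UniformSpace.ball_mem_nhds y hW₁)
  let A : X → Set G := fun y => {g | g • x₀ ∈ interior (UniformSpace.ball y W₁)}
  have hAo : ∀ y, IsOpen (A y) := fun y =>
    isOpen_interior.preimage (continuous_id.smul continuous_const)
  have hex : ∀ K : 𝒦, ∃ y, (t.card : ℝ≥0∞)⁻¹ ≤ compactSubgroupHaar K.1 (h𝒦 K.1 K.2) (A y) := by
    intro K
    have := isProbabilityMeasure_compactSubgroupHaar K.1 (h𝒦 K.1 K.2)
    by_contra! hcon
    have hcov : (Set.univ : Set G) ⊆ ⋃ y ∈ t, A y := fun g _ => by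
      have := ht (Set.mem_univ (g • x₀))
      simpa [A] using this
    have htne : t.Nonempty := by
      obtain ⟨y, hy⟩ := Set.mem_iUnion.mp (ht (Set.mem_univ x₀))
      obtain ⟨hy, -⟩ := Set.mem_iUnion.mp hy
      exact ⟨y, hy⟩
    have h1 := (measure_mono hcov).trans
      (measure_biUnion_finset_le (μ := compactSubgroupHaar K.1 (h𝒦 K.1 K.2)) t _)
    rw [measure_univ] at h1
    have h2 := ENNReal.sum_lt_sum_of_nonempty htne fun y _ => hcon y
    rw [Finset.sum_const, nsmul_eq_mul, ENNReal.mul_inv_cancel (by simpa using htne.ne_empty)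
      (ENNReal.natCast_ne_top _)] at h2
    exact absurd h2 (not_lt.mpr h1)
  -- The ball may change with `K`; concentration allows the sets to vary, provided their measures
  -- stay above the common bound `(t.card)⁻¹`.
  choose y hy using hex
  obtain ⟨K₀, hK₀, hFK₀⟩ := DirectedOn.exists_forall_finset_mem hne hdir F hF
  have : Nonempty 𝒦 := ⟨⟨K₀, hK₀⟩⟩
  have : IsDirectedOrder 𝒦 := ⟨fun a b => by
    obtain ⟨c, hc, hac, hbc⟩ := hdir a.1 a.2 b.1 b.2
    exact ⟨⟨c, hc⟩, hac, hbc⟩⟩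
  -- Inverses of elements of `O` move every point by at most `W₁`; the inverse is needed because the
  -- entourage `V` below tests `a * x⁻¹`, whereas `x = (a * x⁻¹)⁻¹ * a`.
  obtain ⟨O, hO, hOo, hO1⟩ := eventually_nhds_iff.mp
    ((continuous_inv.tendsto' (1 : G) 1 inv_one).eventually
      (eventually_forall_smul_mem_uniformity (G := G) hW₁))
  let V : Set (G × G) := (fun p : G × G => p.2 * p.1⁻¹) ⁻¹' {g | g ∈ {g | g ∈ O}}
  have hlim := hconc (fun K => A (y K)) (fun K => (hAo _).measurableSet)
    (lt_of_lt_of_le (ENNReal.inv_pos.mpr (ENNReal.natCast_ne_top t.card))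
      (le_liminf_of_le (by isBoundedDefault) (Eventually.of_forall hy)))
    V (preimage_mem_comap (hOo.mem_nhds hO1))
  -- Chosen for the union bound over `insert 1 F`; the element `1` is included so that `h` itself
  -- lies in `E`.
  let c : ℝ≥0∞ := 1 - ((insert 1 F).card + 1 : ℝ≥0∞)⁻¹
  have hc : c < 1 := ENNReal.sub_lt_self ENNReal.one_ne_top one_ne_zero (by simp)
  obtain ⟨K, hKc, hKK₀⟩ := ((hlim.eventually (lt_mem_nhds hc)).and
    (eventually_ge_atTop (⟨K₀, hK₀⟩ : 𝒦))).exists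
  set E : Set G := {x | ∃ a ∈ A (y K), (x, a) ∈ V} with hEdef
  have hEo : IsOpen E := by
    have : E = ⋃ a ∈ A (y K), (fun x => a * x⁻¹) ⁻¹' O := by
      ext x
      simp [E, V]
    rw [this]
    exact isOpen_biUnion fun a _ => hOo.preimage (continuous_const.mul continuous_inv)
  have := isProbabilityMeasure_compactSubgroupHaar K.1 (h𝒦 K.1 K.2)
  obtain ⟨h, hh⟩ := exists_forall_mul_mem_of_measure_lt K.1 (h𝒦 K.1 K.2) (insert 1 F)
    (fun g hg => by
      rcases Finset.mem_insert.mp hg with rfl | hg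
      exacts [one_mem _, hKK₀ (hFK₀ g hg)]) hEo.measurableSet (by
    rw [prob_compl_eq_one_sub hEo.measurableSet]
    have h1 : 1 - compactSubgroupHaar K.1 (h𝒦 K.1 K.2) E ≤
        ((insert 1 F).card + 1 : ℝ≥0∞)⁻¹ := by
      rw [tsub_le_iff_right, ← tsub_le_iff_left]
      exact hKc.le
    refine (mul_le_mul_right h1 _).trans_lt ?_
    rw [← div_eq_mul_inv]
    refine (ENNReal.div_lt_iff (by simp) (by simp)).mpr ?_
    rw [one_mul]
    exact_mod_cast Nat.lt_succ_self _)
  have hball : ∀ g ∈ insert 1 F, (g • h • x₀, y K) ∈ W₂ := fun g hg => by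
    obtain ⟨a, ha, haV⟩ := hh g hg
    have ha' : (y K, a • x₀) ∈ W₁ := interior_subset (s := UniformSpace.ball (y K) W₁) ha
    refine hW₁W ⟨a • x₀, ?_, SetRel.symm W₁ ha'⟩
    have h1 : (a * (g * h)⁻¹)⁻¹ • a • x₀ = g • h • x₀ := by
      simp [smul_smul]
    have h2 := hO _ haV (a • x₀)
    rwa [h1] at h2
  refine ⟨h • x₀, fun g hg => hW₂W ⟨y K, ?_, SetRel.symm W₂ (hball g (Finset.mem_insert_of_mem hg))⟩⟩
  simpa using hball 1 (Finset.mem_insert_self 1 F)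

/-- The Gromov–Milman theorem: Lévy groups are extremely amenable. -/
theorem IsLevyGroup.isExtremelyAmenable {G : Type u} [Group G] [TopologicalSpace G]
    [IsTopologicalGroup G] (h : IsLevyGroup G) : IsExtremelyAmenable.{u, v} G := by
  intro X _ _ _ _ _ _
  let : UniformSpace X := uniformSpaceOfCompactR1
  let : MeasurableSpace G := borel G
  have : BorelSpace G := ⟨rfl⟩
  obtain ⟨𝒦, h𝒦, hne, hdir, hdense, hconc⟩ := h
  let D : Set G := ⋃ K ∈ 𝒦, (K : Set G)
  -- Almost fixed points give the finite intersection property, so all these closed conditions hold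
  -- at a single point. That point is fixed by `D`, and its stabilizer is closed.
  let C : D × {W : Set (X × X) // W ∈ uniformity X ∧ IsClosed W} → Set X :=
    fun i => {x | (x, i.1.1 • x) ∈ i.2.1}
  have hC : ∀ i, IsClosed (C i) := fun i =>
    i.2.2.2.preimage (continuous_id.prodMk (continuous_const_smul i.1.1))
  obtain ⟨x, -, hx⟩ := isCompact_univ.inter_iInter_nonempty C hC fun u => by
    classical
    obtain ⟨x, hx⟩ := IsLevyGroup.exists_forall_mem_uniformity (X := X) h𝒦 hne hdir hconc
      (u.image fun i => i.1.1) (fun g hg => by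
        obtain ⟨i, -, rfl⟩ := Finset.mem_image.mp hg
        exact i.1.2) (W := ⋂ i ∈ u, i.2.1) ((Filter.biInter_finset_mem u).mpr fun i _ => i.2.2.1)
    refine ⟨x, trivial, Set.mem_iInter₂.mpr fun i hi => ?_⟩
    exact Set.mem_iInter₂.mp (hx i.1.1 (Finset.mem_image_of_mem _ hi)) i hi
  have hD : D ⊆ {g | g • x = x} := fun g hg => by
    refine (eq_of_uniformity_basis uniformity_hasBasis_closed fun {W} hW => ?_).symm
    exact Set.mem_iInter.mp hx (⟨g, hg⟩, ⟨W, hW⟩)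
  have hcl : IsClosed {g : G | g • x = x} :=
    isClosed_eq (continuous_id.smul continuous_const) continuous_const
  exact ⟨x, fun g => hcl.closure_subset_iff.mpr hD (hdense g)⟩

/-! ### Lévy groups from sequences of finite groups -/

/-- Integrate the number of `γ` with `φ γ * x ∈ B` in two ways: each term integrates to the measure
of `B`, while on the range the count is constant because right translation permutes the index. No
injectivity of `φ` is involved. -/
theorem compactSubgroupHaar_range {G Γ : Type*} [Group G] [TopologicalSpace G]
    [IsTopologicalGroup G] [T2Space G] [MeasurableSpace G] [BorelSpace G] [Group Γ] [Fintype Γ]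
    (φ : Γ →* G) (hK : IsCompact (φ.range : Set G)) {B : Set G} (hB : MeasurableSet B)
    [DecidablePred fun γ => φ γ ∈ B] :
    (compactSubgroupHaar φ.range hK).real B =
      (Finset.univ.filter fun γ => φ γ ∈ B).card / Fintype.card Γ := by
  set ν := compactSubgroupHaar φ.range hK with hν
  have := isProbabilityMeasure_compactSubgroupHaar φ.range hK
  have h1 : ∫⁻ x, ∑ γ, B.indicator 1 (φ γ * x) ∂ν = Fintype.card Γ * ν B := by
    rw [lintegral_finsetSum (f := fun γ x => B.indicator 1 (φ γ * x)) _ fun γ _ =>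
      (measurable_one.indicator hB).comp (continuous_const_mul (φ γ)).measurable]
    have : ∀ γ, ∫⁻ x, B.indicator 1 (φ γ * x) ∂ν = ν B := fun γ => by
      rw [← compactSubgroupHaar_preimage_mul_left φ.range hK ⟨γ, rfl⟩ hB, ← hν,
        ← lintegral_indicator_one ((continuous_const_mul (φ γ)).measurable hB)]
      rfl
    simp [this]
  have h2 : ∫⁻ x, ∑ γ, B.indicator 1 (φ γ * x) ∂ν =
      (Finset.univ.filter fun γ => φ γ ∈ B).card := by
    have hae : ∀ᵐ x ∂ν, ∑ γ, B.indicator (1 : G → ℝ≥0∞) (φ γ * x) =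
        (Finset.univ.filter fun γ => φ γ ∈ B).card := by
      have h0 : ∀ᵐ x ∂ν, x ∈ (φ.range : Set G) :=
        compactSubgroupHaar_compl φ.range hK hK.isClosed.measurableSet
      filter_upwards [h0] with x hx
      obtain ⟨τ, rfl⟩ := hx
      simp only [← map_mul]
      refine (Equiv.sum_comp (Equiv.mulRight τ) fun γ =>
        B.indicator (1 : G → ℝ≥0∞) (φ γ)).trans ?_
      simp [Set.indicator_apply]
    rw [lintegral_congr_ae hae]
    simp
  have h3 := h1.symm.trans h2
  rw [eq_div_iff (by simp), mul_comm, measureReal_def]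
  have := congrArg ENNReal.toReal h3
  simpa using this

/-- Reduces the Lévy property to counting in finite groups: anything `V`-far from a set of
proportion at least `c` has proportion at most `ε`, uniformly from some level on. -/
theorem isLevyGroup_of_finite {G : Type*} [Group G] [TopologicalSpace G]
    [IsTopologicalGroup G] [T2Space G] (Γ : ℕ → Type*) [∀ n, Group (Γ n)] [∀ n, Fintype (Γ n)]
    (φ : ∀ n, Γ n →* G) (hmono : Monotone fun n => (φ n).range)
    (hdense : Dense (⋃ n, ((φ n).range : Set G)))
    (hconc : ∀ V ∈ 𝓝 (1 : G), ∀ c > (0 : ℝ), ∀ ε > (0 : ℝ), ∃ m, ∀ n ≥ m, ∀ A B : Finset (Γ n),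
      c * Fintype.card (Γ n) ≤ A.card → (∀ b ∈ B, ∀ a ∈ A, φ n (b * a⁻¹) ∉ V) →
        B.card ≤ ε * Fintype.card (Γ n)) :
    IsLevyGroup G := by
  let : UniformSpace G := IsTopologicalGroup.rightUniformSpace G
  let : MeasurableSpace G := borel G
  have : BorelSpace G := ⟨rfl⟩
  have hfin : ∀ n, ((φ n).range : Set G).Finite := fun n => Set.finite_range (φ n)
  have hK : ∀ K ∈ Set.range fun n => (φ n).range, IsCompact (K : Set G) := by
    rintro _ ⟨n, rfl⟩
    exact (hfin n).isCompact
  refine ⟨Set.range fun n => (φ n).range, hK, Set.range_nonempty _, ?_, ?_, ?_⟩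
  · rw [directedOn_range]
    exact hmono.directed_le
  · simpa using hdense
  -- The directed family consists of subgroups, not of levels, and several levels may have the same
  -- range; a range above that of level `m` is also attained at a level at least `m`.
  have hatTop : ∀ p : (Set.range fun n => (φ n).range) → Prop, ∀ m,
      (∀ n ≥ m, p ⟨(φ n).range, n, rfl⟩) → ∀ᶠ K in atTop, p K := fun p m hp => by
    filter_upwards [eventually_ge_atTop (⟨(φ m).range, m, rfl⟩ : Set.range fun n => (φ n).range)]
    rintro ⟨_, n, rfl⟩ hn
    have h1 : (φ (max m n)).range = (φ n).range := by
      rcases le_total m n with h | h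
      · rw [max_eq_right h]
      · rw [max_eq_left h]
        exact le_antisymm hn (hmono h)
    have h2 := hp (max m n) (le_max_left _ _)
    simpa only [h1] using h2
  intro A hA hliminf V hV
  obtain ⟨U, hU, hUV⟩ := mem_comap.mp hV
  obtain ⟨c, hc0, hc⟩ := exists_between hliminf
  have hcA := eventually_lt_of_lt_liminf hc (by isBoundedDefault)
  have hprob : ∀ K : (Set.range fun n => (φ n).range),
    IsProbabilityMeasure (compactSubgroupHaar K.1 (hK K.1 K.2)) := fun K =>
      isProbabilityMeasure_compactSubgroupHaar _ _
  refine tendsto_order.mpr ⟨fun a ha => ?_, fun a ha => Eventually.of_forall fun K =>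
    prob_le_one.trans_lt ha⟩
  have hc1 : c ≠ ∞ := hc.ne_top
  have ha1 : a ≠ ∞ := ha.ne_top
  have ha' : a.toReal < 1 := by
    simpa using (ENNReal.toReal_lt_toReal ha1 ENNReal.one_ne_top).mpr ha
  -- The entourage tests `a * x⁻¹` and the hypothesis tests `b * a⁻¹`, hence the inverse of `U`.
  obtain ⟨m, hm⟩ := hconc U⁻¹ (inv_mem_nhds_one G hU) c.toReal
    (ENNReal.toReal_pos hc0.ne' hc1) ((1 - a.toReal) / 2) (by linarith)
  suffices ∀ᶠ K in atTop, c < compactSubgroupHaar K.1 (hK K.1 K.2) (A K) →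
      a < compactSubgroupHaar K.1 (hK K.1 K.2) {x | ∃ a ∈ A K, (x, a) ∈ V} by
    filter_upwards [hcA, this] with K h1 h2 using h2 h1
  refine hatTop _ m fun n hn hcn => ?_
  classical
  set K : (Set.range fun n => (φ n).range) := ⟨(φ n).range, n, rfl⟩
  set E : Set G := {x | ∃ a ∈ A K, (x, a) ∈ V}
  -- For an arbitrary entourage `E` need not be Borel; its trace on the finite subgroup is.
  refine lt_of_lt_of_le ?_ (measure_mono (Set.inter_subset_right (s := ((φ n).range : Set G))))
  have hEm : MeasurableSet (((φ n).range : Set G) ∩ E) :=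
    ((hfin n).subset Set.inter_subset_left).measurableSet
  have := hprob K
  rw [← ENNReal.toReal_lt_toReal ha1 (measure_ne_top _ _)]
  have hcard : (0 : ℝ) < Fintype.card (Γ n) := by
    exact_mod_cast Fintype.card_pos
  have h1 := compactSubgroupHaar_range (φ n) (hK _ K.2) hEm
  have h2 := compactSubgroupHaar_range (φ n) (hK _ K.2) (hA K)
  have h3 := hm n hn (Finset.univ.filter fun γ => φ n γ ∈ A K)
    (Finset.univ.filter fun γ => φ n γ ∉ ((φ n).range : Set G) ∩ E) (by
      rw [← le_div_iff₀ hcard, ← h2]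
      exact (ENNReal.toReal_lt_toReal hc1 (measure_ne_top _ _)).mpr hcn |>.le) (by
      intro b hb d hd hmem
      simp only [Finset.mem_filter_univ] at hb hd
      refine hb ⟨⟨b, rfl⟩, φ n d, hd, hUV ?_⟩
      simpa using hmem)
  have h4 := Finset.card_filter_add_card_filter_not (s := (Finset.univ : Finset (Γ n)))
    fun γ => φ n γ ∈ ((φ n).range : Set G) ∩ E
  rw [Finset.card_univ] at h4
  have h5 : ((Finset.univ.filter fun γ => φ n γ ∈ ((φ n).range : Set G) ∩ E).card : ℝ) +
      (Finset.univ.filter fun γ => φ n γ ∉ ((φ n).range : Set G) ∩ E).card =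
        Fintype.card (Γ n) := by exact_mod_cast h4
  change _ < (compactSubgroupHaar _ _).real _
  rw [h1, lt_div_iff₀ hcard]
  nlinarith

/-! ### The weak topology in terms of sets of finite measure -/

/-- The integer part of `g` records the index of a spanning set and the fractional part is an
injective real code, squeezed into `(0, 1)` by the sigmoid. -/
theorem exists_measurableEmbedding_measure_preimage_Iic_lt_top {X : Type*} [MeasurableSpace X]
    [StandardBorelSpace X] (μ : Measure X) [SigmaFinite μ] :
    ∃ g : X → ℝ, MeasurableEmbedding g ∧ (∀ x, 0 ≤ g x) ∧ ∀ c, μ (g ⁻¹' Set.Iic c) < ∞ := by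
  obtain ⟨e, he⟩ := exists_measurableEmbedding_real X
  let g : X → ℝ := fun x => spanningSetsIndex μ x + Real.sigmoid (e x)
  have hfloor : ∀ x, ⌊g x⌋₊ = spanningSetsIndex μ x := fun x => by
    have h0 := Real.sigmoid_pos (e x)
    have h1 := Real.sigmoid_lt_one (e x)
    rw [Nat.floor_eq_iff (by positivity)]
    constructor <;> simp only [g] <;> linarith
  refine ⟨g, Measurable.measurableEmbedding ?_ fun x y hxy => ?_, fun x => ?_, fun c => ?_⟩
  · exact (measurable_from_top.comp (measurableSet_spanningSetsIndex μ)).add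
      (Real.sigmoid_strictMono.monotone.measurable.comp he.measurable)
  · have h1 : spanningSetsIndex μ x = spanningSetsIndex μ y := by
      rw [← hfloor, ← hfloor, hxy]
    simp only [g, h1] at hxy
    exact he.injective (Real.sigmoid_strictMono.injective (by linarith))
  · exact add_nonneg (Nat.cast_nonneg _) (Real.sigmoid_pos _).le
  · refine lt_of_le_of_lt (measure_mono fun x hx => ?_) (measure_spanningSets_lt_top μ ⌊c⌋₊)
    refine mem_spanningSets_of_index_le μ x ?_
    rw [← hfloor]
    exact Nat.floor_le_floor hx

namespace WeakAut

variable {X : Type*} [MeasurableSpace X] {μ : Measure X} {p : ℝ≥0∞}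

/-- The quotient map onto the group of automorphisms modulo null sets. -/
def mk (p : ℝ≥0∞) (μ : Measure X) : MPEquiv μ →* WeakAut p μ :=
  QuotientGroup.mk' (MPEquiv.aeTrivial μ)

theorem mk_surjective : Function.Surjective (mk p μ) :=
  QuotientGroup.mk'_surjective _

theorem mk_eq_mk_of_ae_eq {a b : MPEquiv μ} (h : ∀ᵐ x ∂μ, a.1 x = b.1 x) :
    mk p μ a = mk p μ b := by
  refine QuotientGroup.eq.mpr ?_
  change ∀ᵐ x ∂μ, a.1.symm (b.1 x) = x
  filter_upwards [h] with x hx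
  rw [← hx, MeasurableEquiv.symm_apply_apply]

theorem mk_eq_mk_of_inv_ae_eq {a b : MPEquiv μ} (h : ∀ᵐ x ∂μ, (a⁻¹).1 x = (b⁻¹).1 x) :
    mk p μ a = mk p μ b := by
  have := mk_eq_mk_of_ae_eq (p := p) h
  rwa [map_inv, map_inv, inv_inj] at this

variable [Fact (1 ≤ p)]

theorem rep_mk_indicatorConstLp (a : MPEquiv μ) {A : Set X} (hA : MeasurableSet A)
    (hμA : μ A ≠ ∞) (c : ℝ) :
    rep p μ (mk p μ a) (indicatorConstLp p hA hμA c) =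
      indicatorConstLp p (hA.preimage (a⁻¹).2.measurable)
        (by rwa [(a⁻¹).2.measure_preimage hA.nullMeasurableSet]) c :=
  rfl

/-- The countably many sets `{g ≤ q}` with `q` rational have finite measure and separate points, so
the images of their indicators determine an automorphism almost everywhere. -/
theorem t2Space [StandardBorelSpace X] [SigmaFinite μ] : T2Space (WeakAut p μ) := by
  refine T2Space.of_injective_continuous
    (f := fun (T : WeakAut p μ) (f : Lp ℝ p μ) => rep p μ T f) ?_ continuous_induced_dom
  intro S T hST
  obtain ⟨a, rfl⟩ := mk_surjective S
  obtain ⟨b, rfl⟩ := mk_surjective T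
  obtain ⟨g, hg, -, hgμ⟩ := exists_measurableEmbedding_measure_preimage_Iic_lt_top μ
  refine mk_eq_mk_of_inv_ae_eq ?_
  have h : ∀ q : ℚ, ∀ᵐ x ∂μ, g ((a⁻¹).1 x) ≤ q ↔ g ((b⁻¹).1 x) ≤ q := fun q => by
    have h1 := congrFun hST (indicatorConstLp p (hg.measurable measurableSet_Iic)
      (hgμ q).ne 1)
    simp only [rep_mk_indicatorConstLp] at h1
    exact ((indicatorConstLp_inj _ _ _ _ one_ne_zero).mp h1).mem_iff
  filter_upwards [ae_all_iff.mpr h] with x hx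
  refine hg.injective (le_antisymm ?_ ?_) <;> refine le_of_forall_gt fun c hc => ?_
  · obtain ⟨q, hq, hqc⟩ := exists_rat_btwn hc
    exact ((hx q).mpr hq.le).trans_lt hqc
  · obtain ⟨q, hq, hqc⟩ := exists_rat_btwn hc
    exact ((hx q).mp hq.le).trans_lt hqc

theorem isClosed_setOf_tendsto_rep {ι : Type*} (l : Filter ι) (u : ι → WeakAut p μ)
    (T : WeakAut p μ) :
    IsClosed {f : Lp ℝ p μ | Tendsto (fun i => rep p μ (u i) f) l (𝓝 (rep p μ T f))} := by
  refine isClosed_of_closure_subset fun f hf => ?_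
  rw [Set.mem_ofPred_eq, Metric.tendsto_nhds]
  intro ε hε
  obtain ⟨g, hg, hfg⟩ := Metric.mem_closure_iff.mp hf (ε / 3) (by positivity)
  rw [Set.mem_ofPred_eq, Metric.tendsto_nhds] at hg
  filter_upwards [hg (ε / 3) (by positivity)] with i hi
  have h1 := dist_triangle4 (rep p μ (u i) f) (rep p μ (u i) g) (rep p μ T g) (rep p μ T f)
  rw [LinearIsometryEquiv.dist_map, LinearIsometryEquiv.dist_map, dist_comm g f] at h1
  linarith

/-- The conditions on finitely many sets generate a filter. Along it, convergence is clear on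
indicators, hence on simple functions, and passes to all of `L^p` by density because the operators
are isometries. -/
theorem exists_finset_of_mem_nhds (hp : p ≠ ∞) (a : MPEquiv μ) {U : Set (WeakAut p μ)}
    (hU : U ∈ 𝓝 (mk p μ a)) :
    ∃ F : Finset {A : Set X // MeasurableSet A ∧ μ A ≠ ∞}, ∃ δ : ℝ≥0∞, 0 < δ ∧
      ∀ b : MPEquiv μ, (∀ A ∈ F, μ (((b⁻¹).1 ⁻¹' A.1) ∆ ((a⁻¹).1 ⁻¹' A.1)) < δ) →
        mk p μ b ∈ U := by
  classical
  let N : Finset {A : Set X // MeasurableSet A ∧ μ A ≠ ∞} × {δ : ℝ≥0∞ // 0 < δ} →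
      Set (MPEquiv μ) := fun i =>
    {b | ∀ A ∈ i.1, μ (((b⁻¹).1 ⁻¹' A.1) ∆ ((a⁻¹).1 ⁻¹' A.1)) < i.2.1}
  let l : Filter (MPEquiv μ) := ⨅ i, 𝓟 (N i)
  have : Nonempty {δ : ℝ≥0∞ // 0 < δ} := ⟨⟨1, one_pos⟩⟩
  have hdir : Directed (· ≥ ·) fun i => 𝓟 (N i) := by
    rintro ⟨F, δ⟩ ⟨F', δ'⟩
    refine ⟨⟨F ∪ F', ⟨min δ.1 δ'.1, lt_min δ.2 δ'.2⟩⟩, ?_, ?_⟩ <;>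
      refine principal_mono.mpr fun b hb A hA => ?_
    · exact (hb A (Finset.mem_union_left _ hA)).trans_le (min_le_left _ _)
    · exact (hb A (Finset.mem_union_right _ hA)).trans_le (min_le_right _ _)
  have hl : Tendsto (mk p μ) l (𝓝 (mk p μ a)) := by
    refine tendsto_iff.mpr fun f => ?_
    induction f using Lp.induction hp with
    | indicatorConst c hs hμs =>
      rw [Lp.simpleFunc.coe_indicatorConst]
      simp only [rep_mk_indicatorConstLp]
      refine tendsto_indicatorConstLp_set hp ?_
      refine ENNReal.tendsto_nhds_zero.mpr fun δ hδ => ?_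
      refine mem_of_superset (mem_iInf_of_mem
        (⟨{⟨_, hs, hμs.ne⟩}, ⟨δ, hδ⟩⟩ : _ × _) (mem_principal_self _)) fun b hb => ?_
      exact (hb _ (Finset.mem_singleton_self _)).le
    | add hf hg _ h1 h2 =>
      simp only [map_add]
      exact h1.add h2
    | isClosed => exact isClosed_setOf_tendsto_rep l _ _
  obtain ⟨⟨F, δ⟩, hi⟩ := (mem_iInf_of_directed hdir _).mp (hl hU)
  exact ⟨F, δ.1, δ.2, fun b hb => hi hb⟩

end WeakAut

/-! ### Non-atomic standard Borel spaces are almost everywhere isomorphic to intervals -/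

/-- The distribution function is a primitive of the constant `1` with respect to `ν`, and primitives
are continuous when points are null. -/
theorem continuous_measureReal_Iic (ν : Measure ℝ) [NullSingletonClass ν]
    (h0 : ν (Set.Iic (-1)) = 0) (hfin : ∀ c, ν (Set.Iic c) < ∞) :
    Continuous fun c => ν.real (Set.Iic c) := by
  have hint : ∀ a b : ℝ, IntervalIntegrable (fun _ => (1 : ℝ)) ν a b := fun a b => by
    rw [intervalIntegrable_const_iff]
    exact Or.inr ((measure_mono fun x hx => hx.2).trans_lt (hfin (max a b)))
  refine (intervalIntegral.continuous_primitive hint (-1)).congr fun c => ?_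
  rw [intervalIntegral.integral_const', smul_eq_mul, mul_one]
  rcases le_total (-1) c with hc | hc
  · rw [Set.Ioc_eq_empty (not_lt.mpr hc), measureReal_empty, sub_zero, ← Set.Iic_union_Ioc_eq_Iic hc]
    have h1 : ν.real (Set.Iic (-1)) = 0 := by simp [measureReal_def, h0]
    rw [measureReal_union (Set.Iic_disjoint_Ioc le_rfl) measurableSet_Ioc (hfin _).ne
      ((measure_mono Set.Ioc_subset_Iic_self).trans_lt (hfin c)).ne, h1, zero_add]
  · have h1 : ν.real (Set.Iic c) = 0 := by
      simp [measureReal_def, measure_mono_null (Set.Iic_subset_Iic.mpr hc) h0]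
    have h2 : ν.real (Set.Ioc c (-1)) = 0 := by
      simp [measureReal_def, measure_mono_null Set.Ioc_subset_Iic_self h0]
    rw [Set.Ioc_eq_empty (not_lt.mpr hc), h1, h2]
    simp

/-- The interval `[0, M)`. -/
def initialInterval (M : ℝ≥0∞) : Set ℝ := {t | 0 ≤ t ∧ ENNReal.ofReal t < M}

theorem initialInterval_top : initialInterval ∞ = Set.Ici 0 := by
  ext t
  simp [initialInterval]

theorem initialInterval_of_ne_top {M : ℝ≥0∞} (hM : M ≠ ∞) :
    initialInterval M = Set.Ico 0 M.toReal := by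
  ext t
  simp [initialInterval]
  intro ht
  rw [ENNReal.ofReal_lt_iff_lt_toReal ht hM]

theorem measurableSet_initialInterval (M : ℝ≥0∞) : MeasurableSet (initialInterval M) := by
  rcases eq_or_ne M ∞ with rfl | hM
  · rw [initialInterval_top]
    exact measurableSet_Ici
  · rw [initialInterval_of_ne_top hM]
    exact measurableSet_Ico

theorem volume_restrict_initialInterval_Iic (M : ℝ≥0∞) (t : ℝ) :
    volume.restrict (initialInterval M) (Set.Iic t) = min (ENNReal.ofReal t) M := by
  rw [Measure.restrict_apply measurableSet_Iic]
  rcases eq_or_ne M ∞ with rfl | hM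
  · rw [initialInterval_top, Set.inter_comm, Set.Ici_inter_Iic, Real.volume_Icc, sub_zero,
      min_eq_left le_top]
  · rw [initialInterval_of_ne_top hM]
    rcases lt_or_ge t M.toReal with ht | ht
    · have : Set.Iic t ∩ Set.Ico 0 M.toReal = Set.Icc 0 t := by
        ext x
        simp only [Set.mem_inter_iff, Set.mem_Iic, Set.mem_Ico, Set.mem_Icc]
        exact ⟨fun h => ⟨h.2.1, h.1⟩, fun h => ⟨h.2, h.1, h.2.trans_lt ht⟩⟩
      rw [this, Real.volume_Icc, sub_zero, min_eq_left]
      exact ENNReal.ofReal_le_of_le_toReal ht.le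
    · have : Set.Iic t ∩ Set.Ico 0 M.toReal = Set.Ico 0 M.toReal := by
        rw [Set.inter_eq_right]
        exact fun x hx => hx.2.le.trans ht
      rw [this, Real.volume_Ico, sub_zero, ENNReal.ofReal_toReal hM, min_eq_right]
      rwa [ENNReal.le_ofReal_iff_toReal_le hM (ENNReal.toReal_nonneg.trans ht)]

theorem Measure.ext_of_Iic_of_isLocallyFiniteMeasure {ν ν' : Measure ℝ}
    (hfin : ∀ c, ν (Set.Iic c) < ∞) (h : ∀ c, ν (Set.Iic c) = ν' (Set.Iic c)) : ν = ν' := by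
  have : IsLocallyFiniteMeasure ν :=
    ⟨fun x => ⟨Set.Iic (x + 1), Iic_mem_nhds (by linarith), hfin _⟩⟩
  refine Measure.ext_of_Ioc ν ν' fun a b hab => ?_
  rw [← Set.Iic_sdiff_Iic, measure_sdiff (Set.Iic_subset_Iic.mpr hab.le)
    measurableSet_Iic.nullMeasurableSet (hfin a).ne, measure_sdiff (Set.Iic_subset_Iic.mpr hab.le)
    measurableSet_Iic.nullMeasurableSet ((h a) ▸ (hfin a)).ne, h, h]

section

variable {X : Type*} [MeasurableSpace X] {μ : Measure X} {g : X → ℝ}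

/-- The probability integral transform: composing `g` with its own continuous distribution function
carries `μ` to Lebesgue measure on an initial interval. -/
theorem measure_distribution_le (hgμ : ∀ c, μ (g ⁻¹' Set.Iic c) < ∞)
    (hg0 : ∀ x, 0 ≤ g x) (hH : Continuous fun c => μ.real (g ⁻¹' Set.Iic c)) (t : ℝ) :
    μ {x | μ.real (g ⁻¹' Set.Iic (g x)) ≤ t} = min (ENNReal.ofReal t) (μ Set.univ) := by
  set H : ℝ → ℝ := fun c => μ.real (g ⁻¹' Set.Iic c) with hHdef
  have hmono : Monotone H := fun a b hab =>
    measureReal_mono (Set.preimage_mono (Set.Iic_subset_Iic.mpr hab)) (hgμ b).ne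
  have hof : ∀ c, ENNReal.ofReal (H c) = μ (g ⁻¹' Set.Iic c) := fun c =>
    ENNReal.ofReal_toReal (hgμ c).ne
  rcases lt_or_ge t 0 with ht | ht
  · rw [ENNReal.ofReal_of_nonpos ht.le, min_eq_left zero_le]
    convert measure_empty (μ := μ)
    ext x
    simp only [Set.mem_ofPred_eq, Set.mem_empty_iff_false, iff_false, not_le]
    exact ht.trans_le measureReal_nonneg
  rcases le_or_gt (μ Set.univ) (ENNReal.ofReal t) with hM | hM
  · rw [min_eq_right hM]
    congr 1
    refine Set.eq_univ_of_forall fun x => ?_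
    rw [Set.mem_ofPred_eq, ← ENNReal.ofReal_le_ofReal_iff ht]
    change ENNReal.ofReal (H (g x)) ≤ _
    rw [hof]
    exact (measure_mono (Set.subset_univ _)).trans hM
  rw [min_eq_left hM.le]
  have hm1 : H (-1) = 0 := by
    have : g ⁻¹' Set.Iic (-1) = ∅ := by
      ext x
      simpa using (by linarith [hg0 x] : (-1 : ℝ) < g x)
    simp [H, this]
  obtain ⟨C, hC⟩ : ∃ C, t < H C := by
    have hU : ⋃ n : ℕ, g ⁻¹' Set.Iic (n : ℝ) = Set.univ := by
      refine Set.eq_univ_of_forall fun x => ?_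
      obtain ⟨n, hn⟩ := exists_nat_ge (g x)
      exact Set.mem_iUnion.mpr ⟨n, hn⟩
    have hlim := tendsto_measure_iUnion_atTop (μ := μ) (s := fun n : ℕ => g ⁻¹' Set.Iic (n : ℝ))
      fun a b hab => Set.preimage_mono (Set.Iic_subset_Iic.mpr (by exact_mod_cast hab))
    rw [hU] at hlim
    obtain ⟨n, hn⟩ := (hlim.eventually (lt_mem_nhds hM)).exists
    refine ⟨n, ?_⟩
    simp only [Function.comp_apply] at hn
    rw [← hof] at hn
    exact (ENNReal.ofReal_lt_ofReal_iff_of_nonneg ht).mp hn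
  obtain ⟨c', hc'⟩ : t ∈ Set.range H :=
    mem_range_of_exists_le_of_exists_ge hH ⟨-1, hm1.trans_le ht⟩ ⟨C, hC.le⟩
  have hbdd : BddAbove {y | H y ≤ t} := ⟨C, fun y hy => by
    by_contra! hlt
    exact absurd (hC.trans_le (hmono hlt.le)) (not_lt.mpr hy)⟩
  -- Where `H` is flat the value `t` has many preimages; the largest makes the sublevel set of `H`
  -- exactly a half-line.
  have hmem : sSup {y | H y ≤ t} ∈ {y | H y ≤ t} :=
    (isClosed_le hH continuous_const).csSup_mem ⟨c', hc'.le⟩ hbdd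
  have hc : H (sSup {y | H y ≤ t}) = t :=
    le_antisymm hmem (hc'.symm.le.trans (hmono (le_csSup hbdd hc'.le)))
  have hset : {x | H (g x) ≤ t} = g ⁻¹' Set.Iic (sSup {y | H y ≤ t}) := by
    ext x
    exact ⟨fun hx => le_csSup hbdd hx, fun hx => (hmono hx).trans hc.le⟩
  rw [hset, ← hof, hc]

end

/-- A non-atomic `σ`-finite standard Borel space is isomorphic modulo null sets to an interval with
Lebesgue measure. -/
theorem exists_ae_equiv_initialInterval {X : Type*} [MeasurableSpace X] [StandardBorelSpace X]
    (μ : Measure X) [SigmaFinite μ] [NullSingletonClass μ] (hμ : μ ≠ 0) :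
    ∃ (θ : X → ℝ) (ψ : ℝ → X), Measurable θ ∧ Measurable ψ ∧ (∀ᵐ x ∂μ, ψ (θ x) = x) ∧
      μ.map θ = volume.restrict (initialInterval (μ Set.univ)) := by
  obtain ⟨g, hg, hg0, hgμ⟩ := exists_measurableEmbedding_measure_preimage_Iic_lt_top μ
  let H : ℝ → ℝ := fun c => μ.real (g ⁻¹' Set.Iic c)
  have hmono : Monotone H := fun a b hab =>
    measureReal_mono (Set.preimage_mono (Set.Iic_subset_Iic.mpr hab)) (hgμ b).ne
  have hH : Continuous H := by
    have hap : ∀ c, μ.map g (Set.Iic c) = μ (g ⁻¹' Set.Iic c) := fun c =>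
      Measure.map_apply hg.measurable measurableSet_Iic
    have : NullSingletonClass (μ.map g) := ⟨fun c => by
      rw [Measure.map_apply hg.measurable (measurableSet_singleton c)]
      exact (Set.subsingleton_singleton.preimage hg.injective).measure_zero μ⟩
    refine (continuous_measureReal_Iic (μ.map g) ?_ fun c => hap c ▸ hgμ c).congr fun c => ?_
    · rw [hap]
      convert measure_empty (μ := μ)
      ext x
      simpa using (by linarith [hg0 x] : (-1 : ℝ) < g x)
    · simp [H, measureReal_def, hap]
  let θ : X → ℝ := fun x => H (g x)
  have hθ : Measurable θ := hH.measurable.comp hg.measurable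
  have hmap : μ.map θ = volume.restrict (initialInterval (μ Set.univ)) := by
    have h1 : ∀ t, μ.map θ (Set.Iic t) = min (ENNReal.ofReal t) (μ Set.univ) := fun t => by
      rw [Measure.map_apply hθ measurableSet_Iic]
      exact measure_distribution_le hgμ hg0 hH t
    refine Measure.ext_of_Iic_of_isLocallyFiniteMeasure (fun t => ?_) fun t => ?_
    · rw [h1]
      exact (min_le_left _ _).trans_lt ENNReal.ofReal_lt_top
    · rw [h1, volume_restrict_initialInterval_Iic]
  have hD : (Set.range fun q : ℚ => H q).Countable := Set.countable_range _
  -- `θ` can identify two points only across an interval on which `H` is constant. It contains a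
  -- rational, so discarding the countably many values of `H` at rationals, a null set, makes `θ`
  -- injective.
  let X₀ : Set X := θ ⁻¹' (Set.range fun q : ℚ => H q)ᶜ
  have hX₀ : MeasurableSet X₀ := hθ hD.measurableSet.compl
  have hae : ∀ᵐ x ∂μ, x ∈ X₀ := by
    have : μ (θ ⁻¹' (Set.range fun q : ℚ => H q)) = 0 := by
      rw [← Measure.map_apply hθ hD.measurableSet, hmap]
      exact hD.measure_zero _
    rw [ae_iff]
    convert this using 2
    ext x
    simp [X₀]
  have hinj : ∀ x ∈ X₀, ∀ y, θ x = θ y → ¬ g x < g y := fun x hx y hxy hlt => by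
    obtain ⟨q, hq, hq'⟩ := exists_rat_btwn hlt
    exact hx ⟨q, le_antisymm ((hmono hq'.le).trans hxy.symm.le) (hmono hq.le)⟩
  have := hX₀.standardBorel
  have hemb : MeasurableEmbedding fun x : X₀ => θ x :=
    (hθ.comp measurable_subtype_coe).measurableEmbedding fun x y hxy =>
      Subtype.ext (hg.injective (le_antisymm (not_lt.mp (hinj y y.2 x hxy.symm))
        (not_lt.mp (hinj x x.2 y hxy))))
  have hne : Nonempty X := by
    by_contra hempty
    rw [not_nonempty_iff] at hempty
    exact hμ (Measure.eq_zero_of_isEmpty μ)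
  obtain ⟨ψ, hψ, hψθ⟩ := hemb.exists_measurable_extend measurable_subtype_coe fun _ => hne
  refine ⟨θ, ψ, hθ, hψ, ?_, hmap⟩
  filter_upwards [hae] with x hx using congrFun hψθ ⟨x, hx⟩

/-! ### Systems of interval exchanges -/

/-- A refining sequence of finite families of disjoint sets of equal measure that approximate all
sets of finite measure, together with actions of the symmetric groups that permute the sets of each
family. -/
structure ExchangeSystem {X : Type*} [MeasurableSpace X] (μ : Measure X) where
  /-- The index set of the family of level `n`. -/
  ι : ℕ → Type
  /-- The sets of level `n`. -/
  P : ∀ n, ι n → Set X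
  /-- The measure of the sets of level `n`. -/
  len : ℕ → ℝ
  /-- The action of the symmetric group of level `n`. -/
  ρ : ∀ n, Equiv.Perm (ι n) →* MPEquiv μ
  [fintype : ∀ n, Fintype (ι n)]
  [decidableEq : ∀ n, DecidableEq (ι n)]
  len_pos : ∀ n, 0 < len n
  measurableSet_P : ∀ n i, MeasurableSet (P n i)
  disjoint_P : ∀ n, Pairwise (Function.onFun Disjoint (P n))
  measure_P : ∀ n i, μ (P n i) = ENNReal.ofReal (len n)
  refine_P : ∀ n m, n ≤ m → ∀ j, ∃ C : Finset (ι m), P n j = ⋃ i ∈ C, P m i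
  approx : ∀ A, MeasurableSet A → μ A ≠ ∞ → ∀ ε : ℝ≥0∞, 0 < ε →
    ∃ m₀, ∀ m ≥ m₀, ∃ S : Finset (ι m), μ (A ∆ ⋃ i ∈ S, P m i) ≤ ε
  preimage_P : ∀ n s i, ((ρ n s)⁻¹).1 ⁻¹' P n i =ᵐ[μ] P n (s i)
  measure_support_le : ∀ n s, μ {x | ((ρ n s)⁻¹).1 x ≠ x} ≤
    (Finset.univ.filter fun i => s i ≠ i).card * ENNReal.ofReal (len n)
  tendsto_len : Tendsto (fun n => len n ^ 2 * Fintype.card (ι n)) atTop (𝓝 0)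
  ae_eq_succ : ∀ n s, ∃ t, ∀ᵐ x ∂μ, (ρ n s).1 x = (ρ (n + 1) t).1 x

attribute [instance] ExchangeSystem.fintype ExchangeSystem.decidableEq

theorem ENNReal.exists_natCast_mul_lt (K : ℕ) {δ : ℝ≥0∞} (hδ : 0 < δ) :
    ∃ η : ℝ≥0∞, 0 < η ∧ K * η < δ := by
  obtain ⟨n, hn⟩ := ENNReal.exists_inv_nat_lt
    (ENNReal.div_pos hδ.ne' (ENNReal.natCast_ne_top (K + 1))).ne'
  refine ⟨(n : ℝ≥0∞)⁻¹, ENNReal.inv_pos.mpr (ENNReal.natCast_ne_top n), ?_⟩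
  refine lt_of_le_of_lt ?_ (ENNReal.mul_lt_of_lt_div hn)
  rw [mul_comm]
  gcongr
  exact Nat.le_succ K

namespace ExchangeSystem

variable {X : Type*} [MeasurableSpace X] {μ : Measure X} (E : ExchangeSystem μ)

/-- The union of the sets of level `n` with index in `S`. -/
def U (n : ℕ) (S : Finset (E.ι n)) : Set X := ⋃ i ∈ S, E.P n i

theorem measurableSet_U (n : ℕ) (S : Finset (E.ι n)) : MeasurableSet (E.U n S) :=
  S.measurableSet_biUnion fun i _ => E.measurableSet_P n i

theorem measure_U (n : ℕ) (S : Finset (E.ι n)) :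
    μ (E.U n S) = S.card * ENNReal.ofReal (E.len n) := by
  rw [U, measure_biUnion_finset (fun i _ j _ hij => E.disjoint_P n hij)
    fun i _ => E.measurableSet_P n i]
  simp [E.measure_P]

theorem mem_U {n : ℕ} {S : Finset (E.ι n)} {x : X} : x ∈ E.U n S ↔ ∃ i ∈ S, x ∈ E.P n i := by
  simp [U]

theorem eq_of_mem_P {n : ℕ} {i j : E.ι n} {x : X} (hi : x ∈ E.P n i) (hj : x ∈ E.P n j) :
    i = j := by
  by_contra hij
  exact Set.disjoint_left.mp (E.disjoint_P n hij) hi hj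

theorem nonempty_P (n : ℕ) (i : E.ι n) : (E.P n i).Nonempty := by
  refine nonempty_of_measure_ne_zero (μ := μ) ?_
  rw [E.measure_P]
  simpa using E.len_pos n

theorem exists_approx_finset {J : Type*} (F : Finset J) (A : J → Set X)
    (hA : ∀ j ∈ F, MeasurableSet (A j) ∧ μ (A j) ≠ ∞) {ε : ℝ≥0∞} (hε : 0 < ε) (n : ℕ) :
    ∃ m ≥ n, ∀ j ∈ F, ∃ S : Finset (E.ι m), μ (A j ∆ E.U m S) ≤ ε := by
  have h : ∀ j ∈ F, ∀ᶠ m in atTop, ∃ S : Finset (E.ι m), μ (A j ∆ E.U m S) ≤ ε := fun j hj => by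
    obtain ⟨m₀, hm₀⟩ := E.approx (A j) (hA j hj).1 (hA j hj).2 ε hε
    exact eventually_atTop.mpr ⟨m₀, hm₀⟩
  obtain ⟨m, hm, hnm⟩ := (((Finset.eventually_all F).mpr h).and (eventually_ge_atTop n)).exists
  exact ⟨m, hnm, hm⟩

/-- Disjoint sets of finite measure are approximated by disjoint unions of sets of the system. -/
theorem exists_approx_disjoint {J : Type*} [Fintype J] (Q : J → Set X)
    (hQ : ∀ j, MeasurableSet (Q j) ∧ μ (Q j) ≠ ∞) (hdisj : Pairwise (Function.onFun Disjoint Q))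
    {ε : ℝ≥0∞} (hε : 0 < ε) (n : ℕ) :
    ∃ m ≥ n, ∃ R : J → Finset (E.ι m), Pairwise (Function.onFun Disjoint R) ∧
      ∀ j, μ (Q j ∆ E.U m (R j)) ≤ Fintype.card J * ε := by
  classical
  obtain ⟨m, hnm, hm⟩ := E.exists_approx_finset Finset.univ Q (fun j _ => hQ j) hε n
  choose S hS using fun j => hm j (Finset.mem_univ j)
  -- Cells also chosen for another index are discarded. On a discarded cell, points of `Q j` lie
  -- outside `Q i`, so they are already counted in the error for `i`.
  refine ⟨m, hnm, fun j => S j \ (Finset.univ.erase j).biUnion S, fun i j hij => ?_, fun j => ?_⟩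
  · refine Finset.disjoint_left.mpr fun a hai haj => ?_
    rw [Finset.mem_sdiff, Finset.mem_biUnion] at hai haj
    exact haj.2 ⟨i, Finset.mem_erase.mpr ⟨hij, Finset.mem_univ i⟩, hai.1⟩
  · have hsub : Q j ∆ E.U m (S j \ (Finset.univ.erase j).biUnion S) ⊆
        ⋃ i ∈ Finset.univ, Q i ∆ E.U m (S i) := by
      rintro x (⟨hxQ, hxU⟩ | ⟨hxU, hxQ⟩)
      · by_cases hx : x ∈ E.U m (S j)
        · obtain ⟨a, ha, hxa⟩ := E.mem_U.mp hx
          have : a ∈ (Finset.univ.erase j).biUnion S := by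
            by_contra hna
            exact hxU (E.mem_U.mpr ⟨a, Finset.mem_sdiff.mpr ⟨ha, hna⟩, hxa⟩)
          obtain ⟨i, hi, hai⟩ := Finset.mem_biUnion.mp this
          refine Set.mem_biUnion (Finset.mem_univ i) (Or.inr ⟨E.mem_U.mpr ⟨a, hai, hxa⟩, ?_⟩)
          exact Set.disjoint_right.mp (hdisj (Finset.ne_of_mem_erase hi)) hxQ
        · exact Set.mem_biUnion (Finset.mem_univ j) (Or.inl ⟨hxQ, hx⟩)
      · obtain ⟨a, ha, hxa⟩ := E.mem_U.mp hxU
        exact Set.mem_biUnion (Finset.mem_univ j)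
          (Or.inr ⟨E.mem_U.mpr ⟨a, (Finset.mem_sdiff.mp ha).1, hxa⟩, hxQ⟩)
    refine (measure_mono hsub).trans ((measure_biUnion_finset_le _ _).trans ?_)
    refine (Finset.sum_le_card_nsmul _ _ ε fun i _ => hS i).trans ?_
    simp

theorem preimage_U (n : ℕ) (s : Equiv.Perm (E.ι n)) (S : Finset (E.ι n)) :
    ((E.ρ n s)⁻¹).1 ⁻¹' E.U n S =ᵐ[μ] E.U n (S.map s.toEmbedding) := by
  have h : ∀ᵐ x ∂μ, ∀ i, x ∈ ((E.ρ n s)⁻¹).1 ⁻¹' E.P n i ↔ x ∈ E.P n (s i) :=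
    ae_all_iff.mpr fun i => (E.preimage_P n s i).mem_iff
  refine eventuallyEq_set.mpr ?_
  filter_upwards [h] with x hx
  rw [Set.mem_preimage, E.mem_U, E.mem_U]
  simp only [Finset.mem_map, Equiv.coe_toEmbedding, exists_exists_and_eq_and, ← hx]
  rfl

theorem measure_symmDiff_eq_two_mul {A B : Set X} (hA : MeasurableSet A) (hB : MeasurableSet B)
    (hAB : μ A = μ B) (hfin : μ A ≠ ∞) : μ (A ∆ B) = 2 * μ (A \ B) := by
  have h := measure_sdiff_add_inter (μ := μ) A hB
  have h' := measure_sdiff_add_inter (μ := μ) B hA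
  rw [Set.inter_comm, ← hAB, ← h] at h'
  have hne : μ (A ∩ B) ≠ ∞ := measure_ne_top_of_subset Set.inter_subset_left hfin
  rw [Set.symmDiff_def, measure_union disjoint_sdiff_sdiff (hB.diff hA), two_mul]
  rw [(ENNReal.add_left_inj hne).mp h']

/-- Weak approximation: every automorphism is close to a permutation on the sets of a given
level. -/
theorem exists_measure_symmDiff_le (a : MPEquiv μ) (n : ℕ) {ε : ℝ≥0∞} (hε : 0 < ε) :
    ∃ m, ∃ s : Equiv.Perm (E.ι m), ∀ j : E.ι n,
      μ ((((E.ρ m s)⁻¹).1 ⁻¹' E.P n j) ∆ ((a⁻¹).1 ⁻¹' E.P n j)) ≤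
        4 * Fintype.card (E.ι n) * ε := by
  classical
  let Q : E.ι n → Set X := fun j => (a⁻¹).1 ⁻¹' E.P n j
  have hQm : ∀ j, MeasurableSet (Q j) := fun j => (E.measurableSet_P n j).preimage (a⁻¹).2.measurable
  have hQμ : ∀ j, μ (Q j) = ENNReal.ofReal (E.len n) := fun j => by
    rw [(a⁻¹).2.measure_preimage (E.measurableSet_P n j).nullMeasurableSet, E.measure_P]
  obtain ⟨m, hnm, R, hR, hRQ⟩ := E.exists_approx_disjoint Q
    (fun j => ⟨hQm j, by rw [hQμ]; exact ENNReal.ofReal_ne_top⟩)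
    (fun i j hij => (E.disjoint_P n hij).preimage _) hε n
  choose C hC using E.refine_P n m hnm
  have hCU : ∀ j, E.P n j = E.U m (C j) := hC
  have hCdisj : Pairwise (Function.onFun Disjoint C) := fun i j hij => by
    refine Finset.disjoint_left.mpr fun b hbi hbj => ?_
    obtain ⟨x, hx⟩ := E.nonempty_P m b
    refine hij (E.eq_of_mem_P (x := x) ?_ ?_) <;> rw [hCU]
    exacts [E.mem_U.mpr ⟨b, hbi, hx⟩, E.mem_U.mpr ⟨b, hbj, hx⟩]
  -- `C j` lists the fine cells of `P n j` and `R j` those approximating its image `Q j`; `s` moves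
  -- as many as possible of the former onto the latter.
  obtain ⟨s, hs⟩ := exists_perm_card_filter_notMem_le C R hCdisj hR
  refine ⟨m, s, fun j => ?_⟩
  have hBm : MeasurableSet (((E.ρ m s)⁻¹).1 ⁻¹' E.P n j) :=
    (E.measurableSet_P n j).preimage ((E.ρ m s)⁻¹).2.measurable
  have hBμ : μ (((E.ρ m s)⁻¹).1 ⁻¹' E.P n j) = ENNReal.ofReal (E.len n) := by
    rw [((E.ρ m s)⁻¹).2.measure_preimage (E.measurableSet_P n j).nullMeasurableSet, E.measure_P]
  change μ (_ ∆ Q j) ≤ _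
  rw [measure_symmDiff_eq_two_mul hBm (hQm j) (hBμ.trans (hQμ j).symm)
    (by rw [hBμ]; exact ENNReal.ofReal_ne_top)]
  have h1 : μ ((((E.ρ m s)⁻¹).1 ⁻¹' E.P n j) \ Q j) ≤
      μ (E.U m (R j) \ Q j) + ((C j).card - (R j).card : ℕ) * ENNReal.ofReal (E.len m) := by
    have hae : ((((E.ρ m s)⁻¹).1 ⁻¹' E.P n j) \ Q j : Set X) =ᵐ[μ]
        (E.U m ((C j).map s.toEmbedding) \ Q j : Set X) := by
      rw [hCU]
      exact (E.preimage_U m s (C j)).diff (ae_eq_refl _)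
    rw [measure_congr hae]
    let D : Finset (E.ι m) := ((C j).filter fun i => s i ∉ R j).map s.toEmbedding
    have hsub : E.U m ((C j).map s.toEmbedding) \ Q j ⊆ (E.U m (R j) \ Q j) ∪ E.U m D := by
      rintro x ⟨hx, hxQ⟩
      obtain ⟨b, hb, hxb⟩ := E.mem_U.mp hx
      obtain ⟨i, hi, rfl⟩ := Finset.mem_map.mp hb
      by_cases hiR : s i ∈ R j
      · exact Or.inl ⟨E.mem_U.mpr ⟨_, hiR, hxb⟩, hxQ⟩
      · exact Or.inr (E.mem_U.mpr ⟨_, Finset.mem_map_of_mem _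
          (Finset.mem_filter.mpr ⟨hi, hiR⟩), hxb⟩)
    refine (measure_mono hsub).trans ((measure_union_le _ _).trans ?_)
    rw [E.measure_U m D, Finset.card_map]
    gcongr
    exact hs j
  -- The cells of `C j` that find no place in `R j` have total measure at most `μ (Q j) - μ (E.U m
  -- (R j))`, since `Q j` has the measure of `P n j`; this is again an approximation error.
  have h2 : ((C j).card - (R j).card : ℕ) * ENNReal.ofReal (E.len m) ≤
      μ (Q j \ E.U m (R j)) := by
    rw [ENNReal.natCast_sub, ENNReal.sub_mul fun _ _ => ENNReal.ofReal_ne_top, ← E.measure_U m,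
      ← E.measure_U m, ← hCU, E.measure_P, ← hQμ j]
    exact le_measure_sdiff
  have h3 : μ (E.U m (R j) \ Q j) ≤ Fintype.card (E.ι n) * ε :=
    (measure_mono fun x hx => Or.inr hx).trans (hRQ j)
  have h4 : μ (Q j \ E.U m (R j)) ≤ Fintype.card (E.ι n) * ε :=
    (measure_mono fun x hx => Or.inl hx).trans (hRQ j)
  calc 2 * μ ((((E.ρ m s)⁻¹).1 ⁻¹' E.P n j) \ Q j)
      ≤ 2 * (Fintype.card (E.ι n) * ε + Fintype.card (E.ι n) * ε) := by
        gcongr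
        exact h1.trans (add_le_add h3 (h2.trans h4))
    _ = 4 * Fintype.card (E.ι n) * ε := by ring

theorem measure_symmDiff_U_le {f g : X → X} (n : ℕ) (S : Finset (E.ι n)) {ε : ℝ≥0∞}
    (h : ∀ j, μ ((f ⁻¹' E.P n j) ∆ (g ⁻¹' E.P n j)) ≤ ε) :
    μ ((f ⁻¹' E.U n S) ∆ (g ⁻¹' E.U n S)) ≤ Fintype.card (E.ι n) * ε := by
  have hsub : (f ⁻¹' E.U n S) ∆ (g ⁻¹' E.U n S) ⊆
      ⋃ j ∈ Finset.univ, (f ⁻¹' E.P n j) ∆ (g ⁻¹' E.P n j) := by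
    have hf : ∀ f : X → X, ∀ x, x ∈ f ⁻¹' E.U n S ↔ ∃ j ∈ S, x ∈ f ⁻¹' E.P n j :=
      fun f x => E.mem_U
    intro x hx
    by_contra hcon
    simp only [Finset.mem_univ, Set.iUnion_true, Set.mem_iUnion, not_exists, Set.mem_symmDiff] at hcon
    rw [Set.mem_symmDiff, hf, hf] at hx
    rcases hx with ⟨⟨j, hj, hxj⟩, h2⟩ | ⟨⟨j, hj, hxj⟩, h2⟩
    · exact hcon j (Or.inl ⟨hxj, fun h3 => h2 ⟨j, hj, h3⟩⟩)
    · exact hcon j (Or.inr ⟨hxj, fun h3 => h2 ⟨j, hj, h3⟩⟩)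
  refine (measure_mono hsub).trans ((measure_biUnion_finset_le _ _).trans ?_)
  refine (Finset.sum_le_card_nsmul _ _ ε fun i _ => h i).trans ?_
  simp

/-! ### Density and concentration of the finite groups in the weak topology -/

variable {p : ℝ≥0∞}

/-- The automorphisms of level `n` modulo null sets. -/
def toWeakAut (p : ℝ≥0∞) (n : ℕ) : Equiv.Perm (E.ι n) →* WeakAut p μ :=
  (WeakAut.mk p μ).comp (E.ρ n)

theorem monotone_range_toWeakAut : Monotone fun n => (E.toWeakAut p n).range := by
  refine monotone_nat_of_le_succ fun n => ?_
  rintro _ ⟨s, rfl⟩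
  obtain ⟨t, ht⟩ := E.ae_eq_succ n s
  exact ⟨t, (WeakAut.mk_eq_mk_of_ae_eq ht).symm⟩

variable [Fact (1 ≤ p)]

theorem dense_iUnion_range_toWeakAut (hp : p ≠ ∞) :
    Dense (⋃ n, ((E.toWeakAut p n).range : Set (WeakAut p μ))) := by
  intro T
  obtain ⟨a, rfl⟩ := WeakAut.mk_surjective T
  refine mem_closure_iff_nhds.mpr fun V hV => ?_
  obtain ⟨F, δ, hδ, hF⟩ := WeakAut.exists_finset_of_mem_nhds hp a hV
  obtain ⟨ε, hε, hεδ⟩ := ENNReal.exists_natCast_mul_lt 3 hδ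
  obtain ⟨n, -, hn⟩ := E.exists_approx_finset F (fun A => A.1) (fun A _ => A.2) hε 0
  -- A union of cells accumulates the error `4 * card * η` of each cell, at most `card` times.
  obtain ⟨η, hη, hηε⟩ := ENNReal.exists_natCast_mul_lt
    (Fintype.card (E.ι n) * (4 * Fintype.card (E.ι n))) hε
  obtain ⟨m, s, hs⟩ := E.exists_measure_symmDiff_le a n hη
  refine ⟨WeakAut.mk p μ (E.ρ m s), hF _ fun A hA => ?_, Set.mem_iUnion.mpr ⟨m, s, rfl⟩⟩
  obtain ⟨S, hS⟩ := hn A hA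
  have hpre : ∀ b : MPEquiv μ, μ ((b.1 ⁻¹' A.1) ∆ (b.1 ⁻¹' E.U n S)) ≤ ε := fun b => by
    rw [← Set.preimage_symmDiff,
      b.2.measure_preimage (A.2.1.symmDiff (E.measurableSet_U n S)).nullMeasurableSet]
    exact hS
  have h1 := E.measure_symmDiff_U_le n S hs
  have h2 : μ ((((E.ρ m s)⁻¹).1 ⁻¹' E.U n S) ∆ ((a⁻¹).1 ⁻¹' E.U n S)) ≤ ε := by
    refine h1.trans (le_trans (le_of_eq ?_) hηε.le)
    push_cast
    ring
  refine lt_of_le_of_lt ?_ hεδ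
  calc _ ≤ _ := measure_symmDiff_le _ (((E.ρ m s)⁻¹).1 ⁻¹' E.U n S) _
    _ ≤ _ := add_le_add le_rfl (measure_symmDiff_le _ ((a⁻¹).1 ⁻¹' E.U n S) _)
    _ ≤ ε + (ε + ε) := by
      refine add_le_add (hpre _) (add_le_add h2 ?_)
      rw [symmDiff_comm]
      exact hpre _
    _ = (3 : ℕ) * ε := by push_cast; ring

/-- A permutation displaces any set only inside its own support, so a bound on the measure moved
suffices; the same `δ` serves all levels. -/
theorem exists_toWeakAut_mem (hp : p ≠ ∞) {V : Set (WeakAut p μ)} (hV : V ∈ 𝓝 1) :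
    ∃ δ : ℝ, 0 < δ ∧ ∀ n, ∀ s : Equiv.Perm (E.ι n),
      (Finset.univ.filter fun i => s i ≠ i).card * E.len n < δ → E.toWeakAut p n s ∈ V := by
  obtain ⟨F, δ, hδ, hF⟩ := WeakAut.exists_finset_of_mem_nhds hp (1 : MPEquiv μ)
    (by rwa [map_one] : V ∈ 𝓝 (WeakAut.mk p μ 1))
  obtain ⟨δ', hδ'0, hδ'⟩ := ENNReal.lt_iff_exists_real_btwn.mp hδ
  have hδ'pos : 0 < δ' := by simpa using hδ'.1
  refine ⟨δ', hδ'pos, fun n s hs => hF _ fun A _ => lt_of_le_of_lt ?_ hδ'.2⟩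
  have hsub : (((E.ρ n s)⁻¹).1 ⁻¹' A.1) ∆ (((1 : MPEquiv μ)⁻¹).1 ⁻¹' A.1) ⊆
      {x | ((E.ρ n s)⁻¹).1 x ≠ x} := by
    intro x hx hxeq
    rw [Set.mem_symmDiff, Set.mem_preimage, Set.mem_preimage, hxeq, inv_one, MPEquiv.one_apply] at hx
    tauto
  refine (measure_mono hsub).trans ((E.measure_support_le n s).trans ?_)
  rw [← ENNReal.ofReal_natCast, ← ENNReal.ofReal_mul (Nat.cast_nonneg _)]
  exact ENNReal.ofReal_le_ofReal hs.le

theorem isLevyGroup (E : ExchangeSystem μ) [T2Space (WeakAut p μ)] (hp : p ≠ ∞) :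
    IsLevyGroup (WeakAut p μ) := by
  refine isLevyGroup_of_finite (fun n => Equiv.Perm (E.ι n)) (E.toWeakAut p)
    E.monotone_range_toWeakAut (E.dense_iUnion_range_toWeakAut hp) fun V hV c hc ε hε => ?_
  obtain ⟨δ, hδ, hδV⟩ := E.exists_toWeakAut_mem hp hV
  obtain ⟨m, hm⟩ := eventually_atTop.mp (E.tendsto_len.eventually_lt_const
    (by positivity : 0 < ε * c * δ ^ 2 / 9))
  refine ⟨m, fun n hn A B hA hAB => ?_⟩
  have hlen := E.len_pos n
  have key := card_mul_card_far_mul_sq_le A B (δ / E.len n) (by positivity) fun b hb a ha => by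
    rw [div_le_iff₀ hlen]
    by_contra! hlt
    refine hAB b hb a ha (hδV n _ ?_)
    rw [← hammingDist_perm_mul_right a⁻¹, mul_inv_cancel] at hlt
    exact hlt
  have hcard : (0 : ℝ) < Fintype.card (Equiv.Perm (E.ι n)) := by exact_mod_cast Fintype.card_pos
  set N : ℝ := ((Fintype.card (Equiv.Perm (E.ι n)) : ℕ) : ℝ)
  have h1 : c * N * B.card * (δ / E.len n) ^ 2 ≤ 9 * Fintype.card (E.ι n) * N ^ 2 :=
    le_trans (by gcongr) key
  have h2 : c * B.card * δ ^ 2 ≤ 9 * (E.len n ^ 2 * Fintype.card (E.ι n)) * N := by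
    rw [div_pow, mul_div_assoc', div_le_iff₀ (by positivity)] at h1
    refine le_of_mul_le_mul_left ?_ hcard
    linarith
  have h3 : 9 * (E.len n ^ 2 * Fintype.card (E.ι n)) * N ≤ ε * c * δ ^ 2 * N := by
    refine mul_le_mul_of_nonneg_right ?_ hcard.le
    linarith [hm n hn]
  refine le_of_mul_le_mul_left ?_ (by positivity : 0 < c * δ ^ 2)
  linarith

end ExchangeSystem

/-! ### Lifting finite groups of automorphisms through isomorphisms modulo null sets -/

/-- The maps `ψ ∘ α γ ∘ θ` compose correctly only almost everywhere. Using them on an invariant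
conull set where all the identities hold at once, and the identity map elsewhere, gives a genuine
homomorphism; countability of `Γ` keeps that set conull. -/
theorem exists_lift_mpEquiv {X Y Γ : Type*} [MeasurableSpace X] [StandardBorelSpace X]
    [MeasurableSpace Y] [StandardBorelSpace Y] {μ : Measure X} {ν : Measure Y} {θ : X → Y}
    {ψ : Y → X} (hθ : Measurable θ) (hψ : Measurable ψ) (hψθ : ∀ᵐ x ∂μ, ψ (θ x) = x)
    (hν : μ.map θ = ν) [Group Γ] [Countable Γ] (α : Γ →* MPEquiv ν) :
    ∃ ρ : Γ →* MPEquiv μ, ∀ γ, ∀ᵐ x ∂μ, θ ((ρ γ).1 x) = (α γ).1 (θ x) := by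
  classical
  let X₁ : Set X := {x | ψ (θ x) = x} ∩ ⋂ γ, {x | θ (ψ ((α γ).1 (θ x))) = (α γ).1 (θ x)}
  have hX₁ : MeasurableSet X₁ := by
    refine (measurableSet_eq_fun (hψ.comp hθ) measurable_id).inter (MeasurableSet.iInter fun γ => ?_)
    have h := (α γ).1.measurable.comp hθ
    exact measurableSet_eq_fun (hθ.comp (hψ.comp h)) h
  have hmem : ∀ {x}, x ∈ X₁ ↔
      ψ (θ x) = x ∧ ∀ γ, θ (ψ ((α γ).1 (θ x))) = (α γ).1 (θ x) := fun {x} => by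
    simp [X₁]
  have hqθ : Measure.QuasiMeasurePreserving θ μ ν := ⟨hθ, hν.le.absolutelyContinuous⟩
  have hθψ : ∀ᵐ y ∂ν, θ (ψ y) = y := by
    have hm : MeasurableSet {y | θ (ψ y) = y} :=
      measurableSet_eq_fun (hθ.comp hψ) measurable_id
    rw [← hν, ae_map_iff hθ.aemeasurable hm]
    filter_upwards [hψθ] with x hx
    exact congrArg θ hx
  have hae : ∀ᵐ x ∂μ, x ∈ X₁ := by
    have h : ∀ γ, ∀ᵐ x ∂μ, θ (ψ ((α γ).1 (θ x))) = (α γ).1 (θ x) := fun γ =>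
      hqθ.ae ((α γ).2.quasiMeasurePreserving.ae hθψ)
    filter_upwards [hψθ, ae_all_iff.mpr h] with x h1 h2 using hmem.mpr ⟨h1, h2⟩
  let r : Γ → X → X := fun γ x => if x ∈ X₁ then ψ ((α γ).1 (θ x)) else x
  have hr : ∀ γ {x}, x ∈ X₁ → r γ x = ψ ((α γ).1 (θ x)) := fun γ x hx => if_pos hx
  have hr' : ∀ γ {x}, x ∉ X₁ → r γ x = x := fun γ x hx => if_neg hx
  have hθr : ∀ γ {x}, x ∈ X₁ → θ (r γ x) = (α γ).1 (θ x) := fun γ x hx => by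
    rw [hr γ hx, (hmem.mp hx).2]
  have hrX₁ : ∀ γ {x}, x ∈ X₁ → r γ x ∈ X₁ := fun γ x hx => by
    refine hmem.mpr ⟨?_, fun γ' => ?_⟩
    · rw [hθr γ hx, hr γ hx]
    · rw [hθr γ hx, ← MPEquiv.mul_apply, ← map_mul]
      exact (hmem.mp hx).2 _
  have hrm : ∀ γ, Measurable (r γ) := fun γ =>
    Measurable.ite hX₁ (hψ.comp ((α γ).1.measurable.comp hθ)) measurable_id
  have hr1 : ∀ x, r 1 x = x := fun x => by
    by_cases hx : x ∈ X₁
    · rw [hr 1 hx, map_one, MPEquiv.one_apply, (hmem.mp hx).1]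
    · exact hr' 1 hx
  have hrmul : ∀ γ γ' x, r (γ * γ') x = r γ (r γ' x) := fun γ γ' x => by
    by_cases hx : x ∈ X₁
    · rw [hr _ hx, hr γ (hrX₁ γ' hx), hθr γ' hx, map_mul, MPEquiv.mul_apply]
    · rw [hr' _ hx, hr' _ hx, hr' _ hx]
  let e : Γ → (X ≃ᵐ X) := fun γ =>
    { toFun := r γ
      invFun := r γ⁻¹
      left_inv := fun x => by rw [← hrmul, inv_mul_cancel, hr1]
      right_inv := fun x => by rw [← hrmul, mul_inv_cancel, hr1]
      measurable_toFun := hrm γ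
      measurable_invFun := hrm γ⁻¹ }
  have hmapψ : ν.map ψ = μ := by
    rw [← hν, Measure.map_map hψ hθ, Measure.map_congr (f := ψ ∘ θ) (g := id) hψθ, Measure.map_id]
  have he : ∀ γ, MeasurePreserving (e γ) μ μ := fun γ => by
    refine ⟨hrm γ, ?_⟩
    have h1 : r γ =ᵐ[μ] ψ ∘ (α γ).1 ∘ θ := by
      filter_upwards [hae] with x hx using hr γ hx
    change μ.map (r γ) = μ
    rw [Measure.map_congr h1, ← Measure.map_map hψ ((α γ).1.measurable.comp hθ),
      ← Measure.map_map (α γ).1.measurable hθ, hν, (α γ).2.map_eq, hmapψ]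
  refine ⟨{ toFun := fun γ => ⟨e γ, he γ⟩, map_one' := ?_, map_mul' := fun γ γ' => ?_ },
    fun γ => ?_⟩
  · exact Subtype.ext (MeasurableEquiv.ext (funext hr1))
  · exact Subtype.ext (MeasurableEquiv.ext (funext (hrmul γ γ')))
  · filter_upwards [hae] with x hx using hθr γ hx

/-! ### Interval exchanges of the real line -/

/-- The exchange of the intervals `[j * l, (j + 1) * l)` according to a permutation of the
integers. -/
noncomputable def blockShift (l : ℝ) (s : Equiv.Perm ℤ) (x : ℝ) : ℝ :=
  x + ((s ⌊x / l⌋ : ℝ) - ⌊x / l⌋) * l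

section BlockShift

variable {l : ℝ}

theorem floor_blockShift_div (hl : 0 < l) (s : Equiv.Perm ℤ) (x : ℝ) :
    ⌊blockShift l s x / l⌋ = s ⌊x / l⌋ := by
  have : blockShift l s x / l = x / l + ((s ⌊x / l⌋ - ⌊x / l⌋ : ℤ) : ℝ) := by
    rw [blockShift]
    push_cast
    field_simp
  rw [this, Int.floor_add_intCast]
  ring

theorem blockShift_mul (hl : 0 < l) (s t : Equiv.Perm ℤ) (x : ℝ) :
    blockShift l (s * t) x = blockShift l s (blockShift l t x) := by
  conv_rhs => rw [blockShift, floor_blockShift_div hl]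
  simp only [blockShift, Equiv.Perm.mul_apply]
  ring

theorem blockShift_of_fixed {s : Equiv.Perm ℤ} {x : ℝ} (h : s ⌊x / l⌋ = ⌊x / l⌋) :
    blockShift l s x = x := by
  simp [blockShift, h]

theorem measurable_floor_div (l : ℝ) : Measurable fun x : ℝ => ⌊x / l⌋ :=
  Int.measurable_floor.comp (measurable_id.div_const l)

theorem measurable_blockShift (l : ℝ) (s : Equiv.Perm ℤ) : Measurable (blockShift l s) := by
  have h : Measurable fun j : ℤ => ((s j : ℝ) - j) * l := measurable_from_top
  exact measurable_id.add (h.comp (measurable_floor_div l))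

theorem measure_eq_tsum_preimage_singleton {Ω : Type*} [MeasurableSpace Ω] (ν : Measure Ω)
    {f : Ω → ℤ} (hf : Measurable f) {A : Set Ω} (hA : MeasurableSet A) :
    ν A = ∑' j, ν (A ∩ f ⁻¹' {j}) := by
  rw [← measure_iUnion]
  · congr 1
    ext x
    simp
  · intro i j hij
    refine Set.disjoint_left.mpr fun x hx hx' => hij ?_
    exact hx.2.symm.trans hx'.2
  · exact fun j => hA.inter (hf (measurableSet_singleton j))

/-- Split along the cells: each is translated onto another, and `s` merely reorders the sum. -/
theorem measurePreserving_blockShift (hl : 0 < l) (s : Equiv.Perm ℤ) :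
    MeasurePreserving (blockShift l s) volume volume := by
  refine ⟨measurable_blockShift l s, Measure.ext fun A hA => ?_⟩
  rw [Measure.map_apply (measurable_blockShift l s) hA,
    measure_eq_tsum_preimage_singleton volume (measurable_floor_div l) hA,
    measure_eq_tsum_preimage_singleton volume (measurable_floor_div l)
      (measurable_blockShift l s hA), ← s.tsum_eq fun j => volume (A ∩ _ ⁻¹' {j})]
  refine tsum_congr fun j => ?_
  rw [← measure_preimage_add_right volume (((s j : ℝ) - j) * l)
    (A ∩ (fun x => ⌊x / l⌋) ⁻¹' {s j})]
  congr 1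
  ext x
  have key : ∀ x, ⌊(x + ((s j : ℝ) - j) * l) / l⌋ = ⌊x / l⌋ + (s j - j) := fun x => by
    rw [← Int.floor_add_intCast]
    congr 1
    push_cast
    field_simp
  simp only [Set.mem_inter_iff, Set.mem_preimage, Set.mem_singleton_iff, key]
  constructor
  · rintro ⟨h1, h2⟩
    refine ⟨?_, by omega⟩
    rw [← h2]
    exact h1
  · rintro ⟨h1, h2⟩
    have h3 : ⌊x / l⌋ = j := by omega
    refine ⟨?_, h3⟩
    rw [blockShift, h3]
    exact h1

theorem floor_div_eq_iff (hl : 0 < l) {x : ℝ} {j : ℤ} :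
    ⌊x / l⌋ = j ↔ x ∈ Set.Ico (j * l) ((j + 1) * l) := by
  rw [Int.floor_eq_iff, le_div_iff₀ hl, div_lt_iff₀ hl, Set.mem_Ico]

theorem floor_div_mem_Ico_iff (hl : 0 < l) {x : ℝ} {N : ℕ} :
    ⌊x / l⌋ ∈ Finset.Ico (0 : ℤ) N ↔ x ∈ Set.Ico 0 (N * l) := by
  rw [Finset.mem_Ico, Int.floor_nonneg, Int.floor_lt, Set.mem_Ico, Int.cast_natCast,
    div_lt_iff₀ hl, le_div_iff₀ hl, zero_mul]

theorem volume_floor_div_preimage (hl : 0 < l) (j : ℤ) :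
    volume {x : ℝ | ⌊x / l⌋ = j} = ENNReal.ofReal l := by
  have : {x : ℝ | ⌊x / l⌋ = j} = Set.Ico (j * l) ((j + 1) * l) := by
    ext x
    exact floor_div_eq_iff hl
  rw [this, Real.volume_Ico]
  congr 1
  ring

/-- The permutation of the integers that permutes the blocks of length `k` as `s` permutes the
integers. -/
def blockPerm (k : ℕ) (hk : 0 < k) (s : Equiv.Perm ℤ) : Equiv.Perm ℤ where
  toFun i := k * s (i / k) + i % k
  invFun i := k * s.symm (i / k) + i % k
  left_inv i := by
    have h0 : (0 : ℤ) < k := by exact_mod_cast hk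
    have h1 := Int.emod_nonneg i h0.ne'
    have h2 := Int.emod_lt_of_pos i h0
    have h3 : (k * s (i / k) + i % k) / k = s (i / k) := by
      rw [add_comm, Int.add_mul_ediv_left _ _ h0.ne', Int.ediv_eq_zero_of_lt h1 h2, zero_add]
    dsimp only
    rw [h3, Equiv.symm_apply_apply, Int.mul_add_emod_self_left, Int.emod_emod_of_dvd _ dvd_rfl]
    exact Int.mul_ediv_add_emod i k
  right_inv i := by
    have h0 : (0 : ℤ) < k := by exact_mod_cast hk
    have h1 := Int.emod_nonneg i h0.ne'
    have h2 := Int.emod_lt_of_pos i h0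
    have h3 : (k * s.symm (i / k) + i % k) / k = s.symm (i / k) := by
      rw [add_comm, Int.add_mul_ediv_left _ _ h0.ne', Int.ediv_eq_zero_of_lt h1 h2, zero_add]
    dsimp only
    rw [h3, Equiv.apply_symm_apply, Int.mul_add_emod_self_left, Int.emod_emod_of_dvd _ dvd_rfl]
    exact Int.mul_ediv_add_emod i k

/-- The position `i % k` inside a block is kept, so moving blocks of `k` short intervals is moving
long ones. This nests the groups of successive levels. -/
theorem blockShift_blockPerm {k : ℕ} (hk : 0 < k) (s : Equiv.Perm ℤ) (x : ℝ) :
    blockShift l (blockPerm k hk s) x = blockShift (k * l) s x := by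
  have h1 : ⌊x / (k * l)⌋ = ⌊x / l⌋ / k := by
    rw [mul_comm, ← div_div, Int.floor_div_natCast]
  have h2 : (⌊x / l⌋ : ℝ) = k * (⌊x / l⌋ / k : ℤ) + (⌊x / l⌋ % k : ℤ) := by
    exact_mod_cast (Int.mul_ediv_add_emod ⌊x / l⌋ k).symm
  simp only [blockShift, h1, blockPerm, Equiv.coe_fn_mk]
  push_cast
  linear_combination -l * h2

end BlockShift

/-! ### Exchange systems on intervals and on non-atomic standard Borel spaces -/

/-- Subdivisions of longer and longer parts `[0, num n * len n)` of a set `I` into `num n` intervals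
of length `len n`, each of which refines the previous one. -/
structure IntervalScale (I : Set ℝ) where
  /-- The ratio of the lengths at consecutive levels. -/
  k : ℕ
  /-- The length of the intervals. -/
  len : ℕ → ℝ
  /-- The number of the intervals. -/
  num : ℕ → ℕ
  k_pos : 0 < k
  len_pos : ∀ n, 0 < len n
  len_eq : ∀ n, len n = k * len (n + 1)
  num_le : ∀ n, k * num n ≤ num (n + 1)
  Ico_subset : ∀ n, Set.Ico 0 (num n * len n) ⊆ I
  subset_Ico : ∀ K ⊆ I, IsCompact K → ∀ᶠ m in atTop, K ⊆ Set.Ico 0 (num m * len m)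
  tendsto_len : Tendsto len atTop (𝓝 0)
  tendsto_len_sq : Tendsto (fun n => len n ^ 2 * num n) atTop (𝓝 0)

/-- For `M = ∞`, `8 ^ n` cells of length `4⁻ⁿ` cover `[0, 2 ^ n)`, with `len ^ 2 * num = 2⁻ⁿ`: the
segments exhaust the half-line, yet slowly enough for concentration. For finite `M`, `8 ^ n` cells
fill the interval. -/
theorem nonempty_intervalScale_initialInterval {M : ℝ≥0∞} (hM : M ≠ 0) :
    Nonempty (IntervalScale (initialInterval M)) := by
  rcases eq_or_ne M ∞ with rfl | hM'
  · rw [initialInterval_top]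
    have h2 : ∀ n : ℕ, ((8 ^ n : ℕ) : ℝ) * (1 / 4) ^ n = 2 ^ n := fun n => by
      push_cast
      rw [← mul_pow]
      norm_num
    refine ⟨{ k := 4, len := fun n => (1 / 4) ^ n, num := fun n => 8 ^ n, k_pos := by norm_num,
              len_pos := fun n => by positivity, len_eq := fun n => ?_, num_le := fun n => ?_,
              Ico_subset := fun n x hx => hx.1, subset_Ico := fun K hK hKc => ?_,
              tendsto_len := ?_, tendsto_len_sq := ?_ }⟩
    · push_cast
      ring
    · rw [pow_succ']
      gcongr
      norm_num
    · obtain ⟨C, hC⟩ := hKc.bddAbove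
      filter_upwards [(tendsto_pow_atTop_atTop_of_one_lt
        (one_lt_two : (1 : ℝ) < 2)).eventually_gt_atTop C] with m hm x hx
      rw [h2]
      exact ⟨hK hx, (hC hx).trans_lt hm⟩
    · exact tendsto_pow_atTop_nhds_zero_of_lt_one (by norm_num) (by norm_num)
    · refine (tendsto_pow_atTop_nhds_zero_of_lt_one (r := (1 / 2 : ℝ)) (by norm_num)
        (by norm_num)).congr fun n => ?_
      push_cast
      rw [← pow_mul, mul_comm n 2, pow_mul, ← mul_pow]
      norm_num
  · rw [initialInterval_of_ne_top hM']
    have hpos : 0 < M.toReal := ENNReal.toReal_pos hM hM'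
    have h2 : ∀ n : ℕ, ((8 ^ n : ℕ) : ℝ) * (M.toReal * (1 / 8) ^ n) = M.toReal := fun n => by
      push_cast
      rw [mul_left_comm, ← mul_pow]
      norm_num
    refine ⟨{ k := 8, len := fun n => M.toReal * (1 / 8) ^ n, num := fun n => 8 ^ n,
              k_pos := by norm_num,
              len_pos := fun n => by positivity, len_eq := fun n => ?_, num_le := fun n => ?_,
              Ico_subset := fun n => by rw [h2], subset_Ico := fun K hK hKc => ?_,
              tendsto_len := ?_, tendsto_len_sq := ?_ }⟩
    · push_cast
      ring
    · rw [pow_succ']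
    · refine Eventually.of_forall fun m => ?_
      rwa [h2]
    · simpa using (tendsto_pow_atTop_nhds_zero_of_lt_one (r := (1 / 8 : ℝ)) (by norm_num)
        (by norm_num)).const_mul M.toReal
    · have := (tendsto_pow_atTop_nhds_zero_of_lt_one (r := (1 / 8 : ℝ)) (by norm_num)
        (by norm_num)).const_mul (M.toReal ^ 2)
      rw [mul_zero] at this
      refine this.congr fun n => ?_
      push_cast
      rw [mul_pow, mul_assoc, ← pow_mul, mul_comm n 2, pow_mul, ← mul_pow]
      norm_num

namespace IntervalScale

variable {I : Set ℝ} (D : IntervalScale I)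

/-- The index set of the intervals of level `n`. -/
abbrev index (n : ℕ) : Type := {i : ℤ // i ∈ Finset.Ico (0 : ℤ) (D.num n)}

theorem len_eq_pow_mul (n d : ℕ) : D.len n = (D.k ^ d : ℕ) * D.len (n + d) := by
  induction d with
  | zero => simp
  | succ d ih =>
    rw [ih, D.len_eq (n + d)]
    push_cast
    ring_nf

theorem monotone_num_mul_len : Monotone fun n => D.num n * D.len n := by
  refine monotone_nat_of_le_succ fun n => ?_
  have h1 : ((D.k * D.num n : ℕ) : ℝ) ≤ D.num (n + 1) := by exact_mod_cast D.num_le n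
  rw [D.len_eq n]
  push_cast at h1
  nlinarith [D.len_pos (n + 1)]

theorem floor_mem_of_le {n m : ℕ} (hnm : n ≤ m) {x : ℝ}
    (hx : ⌊x / D.len n⌋ ∈ Finset.Ico (0 : ℤ) (D.num n)) :
    ⌊x / D.len m⌋ ∈ Finset.Ico (0 : ℤ) (D.num m) := by
  rw [floor_div_mem_Ico_iff (D.len_pos _)] at hx ⊢
  exact ⟨hx.1, hx.2.trans_le (D.monotone_num_mul_len hnm)⟩

theorem exists_floor_eq_iff {n m : ℕ} (hnm : n ≤ m) (j : D.index n) :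
    ∃ C : Finset (D.index m), ∀ x : ℝ, ⌊x / D.len n⌋ = j ↔ ∃ i ∈ C, ⌊x / D.len m⌋ = i := by
  obtain ⟨d, rfl⟩ := Nat.exists_eq_add_of_le hnm
  have h : ∀ x : ℝ, ⌊x / D.len n⌋ = ⌊x / D.len (n + d)⌋ / (D.k ^ d : ℕ) := fun x => by
    rw [D.len_eq_pow_mul n d, mul_comm, ← div_div, Int.floor_div_natCast]
  refine ⟨Finset.univ.filter fun i => i.1 / (D.k ^ d : ℕ) = j.1, fun x => ⟨fun hx => ?_, ?_⟩⟩
  · refine ⟨⟨⌊x / D.len (n + d)⌋, D.floor_mem_of_le hnm (hx ▸ j.2)⟩, ?_, rfl⟩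
    rw [Finset.mem_filter_univ, ← h, hx]
  · rintro ⟨i, hi, hxi⟩
    rw [h, hxi]
    exact (Finset.mem_filter_univ i).mp hi

/-- Squeeze `B ∩ I` between a compact `K` and an open `U`. Once the cells are shorter than the
distance allowed around `K`, those meeting `K` cover it and stay inside `U`. -/
theorem exists_approx (hI : MeasurableSet I) {B : Set ℝ} (hB : MeasurableSet B)
    (hBI : volume.restrict I B ≠ ∞) {ε : ℝ≥0∞} (hε : 0 < ε) :
    ∃ m₀, ∀ m ≥ m₀, ∃ S : Finset (D.index m),
      volume.restrict I (B ∆ {x | ∃ i ∈ S, ⌊x / D.len m⌋ = i}) ≤ ε := by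
  classical
  rw [Measure.restrict_apply' hI] at hBI
  have hε2 : ε / 2 ≠ 0 := (ENNReal.half_pos hε.ne').ne'
  obtain ⟨K, hKB, hK, hKε⟩ := (hB.inter hI).exists_isCompact_sdiff_lt hBI hε2
  obtain ⟨U, hBU, hU, -, hUε⟩ := (hB.inter hI).exists_isOpen_sdiff_lt hBI hε2
  obtain ⟨δ, hδ, hδU⟩ := hK.exists_thickening_subset_open hU (hKB.trans hBU)
  obtain ⟨m₀, hm₀⟩ := eventually_atTop.mp
    ((D.subset_Ico K (hKB.trans Set.inter_subset_right) hK).and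
      (D.tendsto_len.eventually_lt_const hδ))
  refine ⟨m₀, fun m hm => ⟨Finset.univ.filter fun i => ∃ x ∈ K, ⌊x / D.len m⌋ = i, ?_⟩⟩
  obtain ⟨hKm, hδm⟩ := hm₀ m hm
  rw [Measure.restrict_apply' hI]
  refine le_trans (measure_mono (t := ((B ∩ I) \ K) ∪ (U \ (B ∩ I))) ?_)
    ((measure_union_le _ _).trans ((add_le_add hKε.le hUε.le).trans (ENNReal.add_halves ε).le))
  rintro x ⟨⟨hxB, hx⟩ | ⟨hx, hxB⟩, hxI⟩
  · refine Or.inl ⟨⟨hxB, hxI⟩, fun hxK => hx ?_⟩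
    refine ⟨⟨⌊x / D.len m⌋, (floor_div_mem_Ico_iff (D.len_pos m)).mpr (hKm hxK)⟩, ?_, rfl⟩
    rw [Finset.mem_filter_univ]
    exact ⟨x, hxK, rfl⟩
  · refine Or.inr ⟨?_, fun h => hxB h.1⟩
    obtain ⟨i, hi, hxi⟩ := hx
    obtain ⟨y, hy, hyi⟩ := (Finset.mem_filter_univ i).mp hi
    refine hδU (Metric.mem_thickening_iff.mpr ⟨y, hy, lt_of_lt_of_le ?_ hδm.le⟩)
    rw [floor_div_eq_iff (D.len_pos m)] at hxi hyi
    rw [Real.dist_eq, abs_lt]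
    constructor <;> linarith [hxi.1, hxi.2, hyi.1, hyi.2]

theorem blockShift_mem_iff (n : ℕ) (s : Equiv.Perm (D.index n)) (x : ℝ) :
    blockShift (D.len n) (Equiv.Perm.ofSubtype s) x ∈ I ↔ x ∈ I := by
  have h : ∀ (s : Equiv.Perm (D.index n)) (x : ℝ), x ∈ I →
      blockShift (D.len n) (Equiv.Perm.ofSubtype s) x ∈ I := fun s x hx => by
    by_cases hF : ⌊x / D.len n⌋ ∈ Finset.Ico (0 : ℤ) (D.num n)
    · refine D.Ico_subset n ((floor_div_mem_Ico_iff (D.len_pos n)).mp ?_)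
      rw [floor_blockShift_div (D.len_pos n), Equiv.Perm.ofSubtype_apply_of_mem s hF]
      exact Subtype.prop _
    · rwa [blockShift_of_fixed (Equiv.Perm.ofSubtype_apply_of_not_mem s hF)]
  refine ⟨fun hx => ?_, h s x⟩
  have := h s⁻¹ _ hx
  rwa [← blockShift_mul (D.len_pos n), ← map_mul, inv_mul_cancel, map_one,
    blockShift_of_fixed rfl] at this

/-- The interval exchanges of level `n`. -/
noncomputable def exchange (hI : MeasurableSet I) (n : ℕ) :
    Equiv.Perm (D.index n) →* MPEquiv (volume.restrict I) where
  toFun s :=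
    ⟨{ toFun := blockShift (D.len n) (Equiv.Perm.ofSubtype s)
       invFun := blockShift (D.len n) (Equiv.Perm.ofSubtype s⁻¹)
       left_inv := fun x => by
        rw [← blockShift_mul (D.len_pos n), ← map_mul, inv_mul_cancel, map_one,
          blockShift_of_fixed rfl]
       right_inv := fun x => by
        rw [← blockShift_mul (D.len_pos n), ← map_mul, mul_inv_cancel, map_one,
          blockShift_of_fixed rfl]
       measurable_toFun := measurable_blockShift _ _
       measurable_invFun := measurable_blockShift _ _ }, by
      have h := (measurePreserving_blockShift (D.len_pos n)
        (Equiv.Perm.ofSubtype s)).restrict_preimage hI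
      have hpre : blockShift (D.len n) (Equiv.Perm.ofSubtype s) ⁻¹' I = I :=
        Set.ext (D.blockShift_mem_iff n s)
      rw [hpre] at h
      exact h⟩
  map_one' := Subtype.ext (MeasurableEquiv.ext (funext fun x => by
    change blockShift (D.len n) (Equiv.Perm.ofSubtype 1) x = x
    rw [map_one, blockShift_of_fixed rfl]))
  map_mul' s t := Subtype.ext (MeasurableEquiv.ext (funext fun x => by
    change blockShift (D.len n) (Equiv.Perm.ofSubtype (s * t)) x = _
    rw [map_mul, blockShift_mul (D.len_pos n)]
    rfl))

/-- The block permutation moves only integers in `[0, k * num n)`, which `num_le` places inside the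
next index set. -/
theorem exists_ofSubtype_eq_blockPerm (n : ℕ) (s : Equiv.Perm (D.index n)) :
    ∃ t : Equiv.Perm (D.index (n + 1)),
      Equiv.Perm.ofSubtype t = blockPerm D.k D.k_pos (Equiv.Perm.ofSubtype s) := by
  set σ := blockPerm D.k D.k_pos (Equiv.Perm.ofSubtype s)
  have hσ : ∀ i, σ i ≠ i → i ∈ Finset.Ico (0 : ℤ) (D.num (n + 1)) := fun i hi => by
    have h0 : (0 : ℤ) < D.k := by exact_mod_cast D.k_pos
    have hF : i / D.k ∈ Finset.Ico (0 : ℤ) (D.num n) := by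
      by_contra hF
      refine hi ?_
      change (D.k : ℤ) * Equiv.Perm.ofSubtype s (i / D.k) + i % D.k = i
      rw [Equiv.Perm.ofSubtype_apply_of_not_mem s hF]
      exact Int.mul_ediv_add_emod i D.k
    have h1 : (D.k : ℤ) * D.num n ≤ D.num (n + 1) := by exact_mod_cast D.num_le n
    rw [Finset.mem_Ico] at hF ⊢
    refine ⟨?_, ?_⟩
    · by_contra! hneg
      exact absurd hF.1 (not_le.mpr (Int.ediv_neg_of_neg_of_pos hneg h0))
    · have := (Int.ediv_lt_iff_lt_mul h0).mp hF.2
      linarith [mul_comm (D.k : ℤ) (D.num n)]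
  have hσ' : ∀ i, σ i ∈ Finset.Ico (0 : ℤ) (D.num (n + 1)) ↔
      i ∈ Finset.Ico (0 : ℤ) (D.num (n + 1)) := fun i => by
    by_cases hi : σ i = i
    · rw [hi]
    · exact iff_of_true (hσ _ fun h => hi (σ.injective h)) (hσ _ hi)
  exact ⟨σ.subtypePerm hσ', Equiv.Perm.ofSubtype_subtypePerm hσ' hσ⟩

end IntervalScale

/-- Everything is pulled back from the interval along `θ`. Sets `A` are handled through `θ ⁻¹' (ψ
⁻¹' A)`, equal to `A` almost everywhere, and the symmetric groups act through lifts of the interval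
exchanges. -/
theorem nonempty_exchangeSystem {X : Type*} [MeasurableSpace X] [StandardBorelSpace X]
    (μ : Measure X) [SigmaFinite μ] [NullSingletonClass μ] (hμ : μ ≠ 0) :
    Nonempty (ExchangeSystem μ) := by
  classical
  obtain ⟨θ, ψ, hθ, hψ, hψθ, hmap⟩ := exists_ae_equiv_initialInterval μ hμ
  have hI := measurableSet_initialInterval (μ Set.univ)
  set I := initialInterval (μ Set.univ)
  obtain ⟨D⟩ : Nonempty (IntervalScale I) :=
    nonempty_intervalScale_initialInterval (by simpa using hμ)
  choose ρ hρ using fun n => exists_lift_mpEquiv hθ hψ hψθ hmap (D.exchange hI n)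
  have hρ' : ∀ n s, ∀ᵐ x ∂μ, θ ((ρ n s).1 x) =
    blockShift (D.len n) (Equiv.Perm.ofSubtype s) (θ x) := hρ
  have hψρ : ∀ n s, ∀ᵐ x ∂μ, ψ (θ ((ρ n s).1 x)) = (ρ n s).1 x := fun n s =>
    (ρ n s).2.quasiMeasurePreserving.ae hψθ
  have hblock : ∀ n i, MeasurableSet {x : ℝ | ⌊x / D.len n⌋ = i} := fun n i =>
    measurable_floor_div (D.len n) (measurableSet_singleton i)
  have hμθ : ∀ {B : Set ℝ}, MeasurableSet B → μ (θ ⁻¹' B) = volume.restrict I B := fun hB => by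
    rw [← hmap, Measure.map_apply hθ hB]
  let P : ∀ n, D.index n → Set X := fun n i => θ ⁻¹' {x | ⌊x / D.len n⌋ = i}
  have hPμ : ∀ n i, μ (P n i) = ENNReal.ofReal (D.len n) := fun n i => by
    rw [hμθ (hblock n i), Measure.restrict_apply' hI, Set.inter_eq_left.mpr,
      volume_floor_div_preimage (D.len_pos n)]
    intro x hx
    refine D.Ico_subset n ((floor_div_mem_Ico_iff (D.len_pos n)).mp ?_)
    rw [Set.mem_ofPred_eq] at hx
    exact hx ▸ i.2
  refine ⟨{ ι := D.index, P := P, len := D.len, ρ := ρ, len_pos := D.len_pos,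
            measurableSet_P := fun n i => hθ (hblock n i), disjoint_P := ?_, measure_P := hPμ,
            refine_P := ?_, approx := ?_, preimage_P := ?_, measure_support_le := ?_,
            tendsto_len := ?_, ae_eq_succ := ?_ }⟩
  · intro n i j hij
    refine Set.disjoint_left.mpr fun x hx hx' => hij (Subtype.ext ?_)
    exact Eq.trans (Eq.symm hx) hx'
  · intro n m hnm j
    obtain ⟨C, hC⟩ := D.exists_floor_eq_iff hnm j
    refine ⟨C, Set.ext fun x => ?_⟩
    simp only [Set.mem_iUnion, exists_prop]
    exact hC (θ x)
  · intro A hA hμA ε hε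
    have hAψ : A =ᵐ[μ] θ ⁻¹' (ψ ⁻¹' A) := by
      refine eventuallyEq_set.mpr ?_
      filter_upwards [hψθ] with x hx
      rw [Set.mem_preimage, Set.mem_preimage, hx]
    obtain ⟨m₀, hm₀⟩ := D.exists_approx hI (hψ hA)
      (by rwa [← hμθ (hψ hA), ← measure_congr hAψ]) hε
    refine ⟨m₀, fun m hm => ?_⟩
    obtain ⟨S, hS⟩ := hm₀ m hm
    refine ⟨S, le_trans (le_of_eq ?_) hS⟩
    have hm : MeasurableSet {x : ℝ | ∃ i ∈ S, ⌊x / D.len m⌋ = i} := by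
      have : {x : ℝ | ∃ i ∈ S, ⌊x / D.len m⌋ = i} = ⋃ i ∈ S, {x : ℝ | ⌊x / D.len m⌋ = i} := by
        ext x
        simp only [Set.mem_iUnion, exists_prop, Set.mem_ofPred_eq]
      rw [this]
      exact S.measurableSet_biUnion fun i _ => hblock m i
    rw [← hμθ ((hψ hA).symmDiff hm), Set.preimage_symmDiff]
    have hU : ⋃ i ∈ S, P m i = θ ⁻¹' {x : ℝ | ∃ i ∈ S, ⌊x / D.len m⌋ = i} := by
      ext x
      simp only [Set.mem_iUnion, exists_prop]
      rfl
    rw [hU]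
    exact measure_congr (hAψ.symmDiff (ae_eq_refl _))
  · intro n s i
    rw [← map_inv]
    refine eventuallyEq_set.mpr ?_
    filter_upwards [hρ' n s⁻¹] with x hx
    change ⌊θ ((ρ n s⁻¹).1 x) / D.len n⌋ = i.1 ↔ ⌊θ x / D.len n⌋ = (s i).1
    rw [hx, floor_blockShift_div (D.len_pos n), map_inv, Equiv.Perm.inv_eq_iff_eq,
      Equiv.Perm.ofSubtype_apply_coe]
  · intro n s
    have hsub : ∀ᵐ x ∂μ, x ∈ {x | ((ρ n s)⁻¹).1 x ≠ x} →
        x ∈ ⋃ i ∈ Finset.univ.filter fun i => s i ≠ i, P n i := by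
      rw [← map_inv]
      filter_upwards [hρ' n s⁻¹, hψθ, hψρ n s⁻¹] with x h1 h2 h3 hx
      by_contra hcon
      simp only [Set.mem_iUnion, exists_prop, Finset.mem_filter_univ, not_exists, not_and] at hcon
      refine hx ?_
      rw [← h3, h1, blockShift_of_fixed, h2]
      by_cases hF : ⌊θ x / D.len n⌋ ∈ Finset.Ico (0 : ℤ) (D.num n)
      · rw [map_inv, Equiv.Perm.inv_eq_iff_eq, Equiv.Perm.ofSubtype_apply_of_mem s hF]
        by_contra hne
        exact hcon ⟨_, hF⟩ (fun h => hne (congrArg Subtype.val h).symm) rfl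
      · exact Equiv.Perm.ofSubtype_apply_of_not_mem _ hF
    refine (measure_mono_ae hsub).trans ((measure_biUnion_finset_le _ _).trans ?_)
    simp [hPμ]
  · simpa using D.tendsto_len_sq
  · intro n s
    obtain ⟨t, ht⟩ := D.exists_ofSubtype_eq_blockPerm n s
    refine ⟨t, ?_⟩
    filter_upwards [hρ' n s, hψρ n s, hρ' (n + 1) t, hψρ (n + 1) t] with x h1 h2 h3 h4
    rw [← h2, ← h4, h1, h3, ht, blockShift_blockPerm, ← D.len_eq]

/-! ### The zero measure and the main theorem -/

/-- Serves `μ = 0`, where all automorphisms are identified and the construction of cells does not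
apply. Nothing is far from a nonempty set, since `1 ∈ V`. -/
theorem isLevyGroup_of_subsingleton {G : Type*} [Group G] [TopologicalSpace G]
    [IsTopologicalGroup G] [Subsingleton G] : IsLevyGroup G := by
  refine isLevyGroup_of_finite (fun _ => Unit) (fun _ => 1) (fun _ _ _ => le_rfl)
    (fun x => subset_closure (Set.mem_iUnion.mpr ⟨0, Subsingleton.elim 1 x ▸ one_mem _⟩))
    fun V hV c hc ε hε => ⟨0, fun n _ A B hA hAB => ?_⟩
  have hAne : A.Nonempty := by
    rw [← Finset.card_pos]
    simp only [Fintype.card_unit, Nat.cast_one, mul_one] at hA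
    exact_mod_cast hc.trans_le hA
  obtain ⟨a, ha⟩ := hAne
  have hB : B = ∅ := Finset.eq_empty_of_forall_notMem fun b hb =>
    hAB b hb a ha (mem_of_mem_nhds hV)
  rw [hB, Finset.card_empty, Nat.cast_zero]
  positivity

theorem mainTheorem3 {X : Type u} [MeasurableSpace X] [StandardBorelSpace X]
    (μ : Measure X) [SigmaFinite μ] [NullSingletonClass μ]
    (p : ℝ≥0∞) [Fact (1 ≤ p)] (hp : p ≠ ∞) :
    T2Space (WeakAut p μ) ∧ IsLevyGroup (WeakAut p μ) ∧
      IsExtremelyAmenable.{u, v} (WeakAut p μ) := by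
  have hT2 : T2Space (WeakAut p μ) := WeakAut.t2Space
  have hLevy : IsLevyGroup (WeakAut p μ) := by
    rcases eq_or_ne μ 0 with rfl | hμ
    · have : Subsingleton (WeakAut p (0 : Measure X)) := ⟨fun S T => by
        obtain ⟨a, rfl⟩ := WeakAut.mk_surjective S
        obtain ⟨b, rfl⟩ := WeakAut.mk_surjective T
        exact WeakAut.mk_eq_mk_of_ae_eq (by simp)⟩
      exact isLevyGroup_of_subsingleton
    · obtain ⟨E⟩ := nonempty_exchangeSystem μ hμ
      exact E.isLevyGroup hp
  exact ⟨hT2, hLevy, hLevy.isExtremelyAmenable⟩
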